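/- An instance of OfflineKnapExp consists of $n$ items, a capacity $B\in\mathbb N$, weights $w_i\in\mathbb N$ with $w_i\le B$, profits $p_i\ge 0$, and for each item an uncertainty interval that is either an open interval $(L_i,U_i)$ containing $p_i$, or trivial, i.e. equal to $\{p_i\}$, in which case $L_i=U_i=p_i$. A packing is a set $P$ of items with $\sum_{i\in P}w_i\le B$; write $p(P)=\sum_{i\in P}p_i$, let $p^*$ be the maximum of $p(P)$ over all packings, and let $\mathcal I_T$ be the set of trivial items. For sets $Q,P$ of items let $U_P(Q)=\sum_{i\in P\cap Q}p_i+\sum_{i\in P\setminus Q}U_i$. A query set $Q$ is $(\alpha,\beta)$-feasible if (1) there is a packing $P\subseteq Q\cup\mathcal I_T$ with $p(P)\ge\frac1\alpha\,p^*$, and (2) $U_P(Q)\le\beta\,p^*$ for every packing $P$. It is feasible if there is a packing $P\subseteq Q\cup\mathcal I_T$ with $p(P)=p^*$ and $U_P(Q)\le p^*$ for every packing $P$. Let $Q^*$ be a feasible query set of minimum cardinality. **Theorem.** Fix a real number $\varepsilon>0$. There is a polynomial-time algorithm that, given an instance of OfflineKnapExp, computes a $\left(\frac{1}{1-\varepsilon},\,4(1+\varepsilon)\right)$-feasible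 query set $Q$ with $|Q|\le 2|Q^*|$. (For $\varepsilon\ge1$ condition (1) is read as $p(P)\ge(1-\varepsilon)p^*$.) Here the algorithm is a program of a random access machine that computes with natural numbers and with profits, using $+,-,\cdot,/$ and comparisons, and its running time is bounded by a polynomial, depending only on $\varepsilon$, in the encoding length of the instance. One and the same program and polynomial work in both of the following senses: (a) if the profits and interval limits are rational, all numbers are encoded in binary and every operation is charged the bit lengths of the numbers involved (logarithmic cost); (b) if the profits and interval limits are arbitrary real numbers, the same holds when each real number has length one and arithmetic operations and comparisons on real numbers have unit cost, while natural numbers (weights, capacity, addresses) are still charged their bit lengths. -/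

import Mathlib

namespace KnapExp

/-! ### Instances, packings and query sets -/

/-- An instance of offline knapsack under explorable uncertainty on the items `Fin n`. The
profits and the limits of the uncertainty intervals live in an ordered field `K`.
Every uncertainty interval is either the open interval `(L i, U i)`, which contains `p i`, or the
trivial interval `{p i}`, and then `L i = U i = p i`. -/
structure Inst (K : Type) [Field K] [LinearOrder K] (n : ℕ) where
  B : ℕ
  w : Fin n → ℕ
  p : Fin n → K
  L : Fin n → K
  U : Fin n → K
  w_le : ∀ i, w i ≤ B
  p_nonneg : ∀ i, 0 ≤ p i
  interval : ∀ i, (L i < p i ∧ p i < U i) ∨ (L i = p i ∧ U i = p i)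

namespace Inst

variable {K : Type} [Field K] [LinearOrder K] {n : ℕ} (I : Inst K n)

/-- The set of trivial items: those whose uncertainty interval is a single point. -/
def trivialItems : Finset (Fin n) := Finset.univ.filter fun i => I.L i = I.U i

/-- A set of items is a packing if its total weight is at most the capacity. -/
def IsPacking (P : Finset (Fin n)) : Prop := ∑ i ∈ P, I.w i ≤ I.B

instance (P : Finset (Fin n)) : Decidable (I.IsPacking P) :=
  inferInstanceAs (Decidable (_ ≤ _))

/-- The profit of a set of items. -/
def profit (P : Finset (Fin n)) : K := ∑ i ∈ P, I.p i

theorem packings_nonempty :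
    (Finset.univ.filter fun P : Finset (Fin n) => I.IsPacking P).Nonempty :=
  ⟨∅, Finset.mem_filter.mpr ⟨Finset.mem_univ _, by simp [IsPacking]⟩⟩

/-- The maximum profit of a packing. -/
def optProfit : K :=
  (Finset.univ.filter fun P : Finset (Fin n) => I.IsPacking P).sup' I.packings_nonempty I.profit

/-- The upper limit of item `i` after querying `Q`. -/
def upper (Q : Finset (Fin n)) (i : Fin n) : K := if i ∈ Q then I.p i else I.U i

/-- The upper limit of the set `P` after querying `Q`. -/
def upperOf (Q P : Finset (Fin n)) : K := ∑ i ∈ P, I.upper Q i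

/-- Feasible query sets. -/
def Feasible (Q : Finset (Fin n)) : Prop :=
  (∃ P, I.IsPacking P ∧ P ⊆ Q ∪ I.trivialItems ∧ I.profit P = I.optProfit) ∧
  ∀ P, I.IsPacking P → I.upperOf Q P ≤ I.optProfit

/-- Optimal query sets: feasible query sets of minimum cardinality. -/
def IsOptimal (Q : Finset (Fin n)) : Prop :=
  I.Feasible Q ∧ ∀ Q', I.Feasible Q' → Q.card ≤ Q'.card

/-- `(α, β)`-feasible query sets. -/
def ABFeasible (α β : K) (Q : Finset (Fin n)) : Prop :=
  (∃ P, I.IsPacking P ∧ P ⊆ Q ∪ I.trivialItems ∧ (1 / α) * I.optProfit ≤ I.profit P) ∧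
  ∀ P, I.IsPacking P → I.upperOf Q P ≤ β * I.optProfit

/-- A rational instance, seen as a real one. -/
def toReal {n : ℕ} (I : Inst ℚ n) : Inst ℝ n where
  B := I.B
  w := I.w
  p := fun i => (I.p i : ℝ)
  L := fun i => (I.L i : ℝ)
  U := fun i => (I.U i : ℝ)
  w_le := I.w_le
  p_nonneg := fun i => by exact_mod_cast I.p_nonneg i
  interval := fun i => by exact_mod_cast I.interval i

/-- The encoding length of an instance, when an element `x` of `K` has length `sz x` and natural
numbers are written in binary. -/
def inputSize (sz : K → ℕ) : ℕ :=
  n + Nat.size I.B + ∑ i, (Nat.size (I.w i) + sz (I.p i) + sz (I.L i) + sz (I.U i))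

end Inst

/-! ### Random access machines

Programs are while-programs over two memories: arrays of natural numbers and arrays of elements
of the field `K`, both with computed addresses. The cost is logarithmic: every operation
is charged one plus the sizes of all addresses and values involved.
The size of a natural number is always its binary length; the size of a field element is
given by a function `sz`. -/

/-- The memory: `nat a j` and `num a j` are the `j`-th cells of the array named `a`. -/
structure State (K : Type) where
  nat : ℕ → ℕ → ℕ
  num : ℕ → ℕ → K

/-- Expressions for natural numbers. -/
inductive NatExpr : Type
  | const (k : ℕ)
  | load (a : ℕ) (i : NatExpr)
  | add (e f : NatExpr)
  | sub (e f : NatExpr)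
  | mul (e f : NatExpr)
  | div (e f : NatExpr)

/-- Expressions for field elements. -/
inductive NumExpr : Type
  | ofNat (e : NatExpr)
  | load (a : ℕ) (i : NatExpr)
  | add (e f : NumExpr)
  | sub (e f : NumExpr)
  | mul (e f : NumExpr)
  | div (e f : NumExpr)

/-- Tests. -/
inductive Test : Type
  | natLe (e f : NatExpr)
  | numLe (e f : NumExpr)
  | not (b : Test)
  | and (b c : Test)

/-- Programs. `setNat a i e` stores the value of `e` in cell `i` of the array `a` of natural
numbers, and `setNum` does so for field elements; `loop b c` is "while `b` do `c`". -/
inductive Cmd : Type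
  | skip
  | setNat (a : ℕ) (i : NatExpr) (e : NatExpr)
  | setNum (a : ℕ) (i : NatExpr) (e : NumExpr)
  | seq (c d : Cmd)
  | ite (b : Test) (c d : Cmd)
  | loop (b : Test) (c : Cmd)

section Semantics

variable {K : Type} [Field K] [LinearOrder K]

/-- Value of an expression (subtraction is truncated, division rounds down, `x / 0 = 0`). -/
def NatExpr.eval (s : State K) : NatExpr → ℕ
  | .const k => k
  | .load a i => s.nat a (i.eval s)
  | .add e f => e.eval s + f.eval s
  | .sub e f => e.eval s - f.eval s
  | .mul e f => e.eval s * f.eval s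
  | .div e f => e.eval s / f.eval s

/-- Cost of evaluating an expression: one plus the size of the value, for every node. -/
def NatExpr.cost (s : State K) : NatExpr → ℕ
  | .const k => 1 + Nat.size k
  | .load a i => i.cost s + 1 + Nat.size ((NatExpr.load a i).eval s)
  | .add e f => e.cost s + f.cost s + 1 + Nat.size ((NatExpr.add e f).eval s)
  | .sub e f => e.cost s + f.cost s + 1 + Nat.size ((NatExpr.sub e f).eval s)
  | .mul e f => e.cost s + f.cost s + 1 + Nat.size ((NatExpr.mul e f).eval s)
  | .div e f => e.cost s + f.cost s + 1 + Nat.size ((NatExpr.div e f).eval s)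

/-- Value of an expression (with `x / 0 = 0`). -/
def NumExpr.eval (s : State K) : NumExpr → K
  | .ofNat e => (e.eval s : K)
  | .load a i => s.num a (i.eval s)
  | .add e f => e.eval s + f.eval s
  | .sub e f => e.eval s - f.eval s
  | .mul e f => e.eval s * f.eval s
  | .div e f => e.eval s / f.eval s

/-- Cost of evaluating an expression: one plus the size of the value, for every node. -/
def NumExpr.cost (sz : K → ℕ) (s : State K) : NumExpr → ℕ
  | .ofNat e => e.cost s + 1 + sz ((NumExpr.ofNat e).eval s)
  | .load a i => i.cost s + 1 + sz ((NumExpr.load a i).eval s)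
  | .add e f => e.cost sz s + f.cost sz s + 1 + sz ((NumExpr.add e f).eval s)
  | .sub e f => e.cost sz s + f.cost sz s + 1 + sz ((NumExpr.sub e f).eval s)
  | .mul e f => e.cost sz s + f.cost sz s + 1 + sz ((NumExpr.mul e f).eval s)
  | .div e f => e.cost sz s + f.cost sz s + 1 + sz ((NumExpr.div e f).eval s)

/-- Truth value of a test. -/
def Test.eval (s : State K) : Test → Bool
  | .natLe e f => decide (e.eval s ≤ f.eval s)
  | .numLe e f => decide (e.eval s ≤ f.eval s)
  | .not b => !(b.eval s)
  | .and b c => b.eval s && c.eval s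

/-- Cost of a test. -/
def Test.cost (sz : K → ℕ) (s : State K) : Test → ℕ
  | .natLe e f => e.cost s + f.cost s + 1
  | .numLe e f => e.cost sz s + f.cost sz s + 1
  | .not b => b.cost sz s + 1
  | .and b c => b.cost sz s + c.cost sz s + 1

/-- Write a natural number into a cell. -/
def State.writeNat (s : State K) (a j v : ℕ) : State K :=
  { s with nat := Function.update s.nat a (Function.update (s.nat a) j v) }

/-- Write a field element into a cell. -/
def State.writeNum (s : State K) (a j : ℕ) (v : K) : State K :=
  { s with num := Function.update s.num a (Function.update (s.num a) j v) }

/-- `Exec sz c s t s'`: started in `s`, the program `c` halts in `s'`, at total cost `t`. -/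
inductive Exec (sz : K → ℕ) : Cmd → State K → ℕ → State K → Prop
  | skip (s : State K) : Exec sz .skip s 1 s
  | setNat (a : ℕ) (i e : NatExpr) (s : State K) :
      Exec sz (.setNat a i e) s (i.cost s + e.cost s + 1) (s.writeNat a (i.eval s) (e.eval s))
  | setNum (a : ℕ) (i : NatExpr) (e : NumExpr) (s : State K) :
      Exec sz (.setNum a i e) s (i.cost s + e.cost sz s + 1) (s.writeNum a (i.eval s) (e.eval s))
  | seq {c d : Cmd} {s s' s'' : State K} {t t' : ℕ}
      (hc : Exec sz c s t s') (hd : Exec sz d s' t' s'') : Exec sz (.seq c d) s (t + t') s''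
  | ite_true {b : Test} {c d : Cmd} {s s' : State K} {t : ℕ} (hb : b.eval s = true)
      (hc : Exec sz c s t s') : Exec sz (.ite b c d) s (b.cost sz s + t) s'
  | ite_false {b : Test} {c d : Cmd} {s s' : State K} {t : ℕ} (hb : b.eval s = false)
      (hd : Exec sz d s t s') : Exec sz (.ite b c d) s (b.cost sz s + t) s'
  | loop_true {b : Test} {c : Cmd} {s s' s'' : State K} {t t' : ℕ} (hb : b.eval s = true)
      (hc : Exec sz c s t s') (hl : Exec sz (.loop b c) s' t' s'') :
      Exec sz (.loop b c) s (b.cost sz s + t + t') s''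
  | loop_false {b : Test} {c : Cmd} {s : State K} (hb : b.eval s = false) :
      Exec sz (.loop b c) s (b.cost sz s) s

/-- The initial memory. Natural numbers: array `0` holds the number of items and the capacity,
array `1` the weights. Field elements: arrays `0`, `1`, `2` hold the profits, the lower limits
and the upper limits. All other cells hold zero. -/
def initState {n : ℕ} (I : Inst K n) : State K where
  nat := fun a j =>
    if a = 0 then (if j = 0 then n else if j = 1 then I.B else 0)
    else if a = 1 then (if h : j < n then I.w ⟨j, h⟩ else 0)
    else 0
  num := fun a j =>
    if h : j < n then
      (if a = 0 then I.p ⟨j, h⟩ else if a = 1 then I.L ⟨j, h⟩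
        else if a = 2 then I.U ⟨j, h⟩ else 0)
    else 0

/-- The set of items written in the final memory: item `i` is in it if and only if cell `i` of the
array `2` of natural numbers is not zero. -/
def output (n : ℕ) (s : State K) : Finset (Fin n) :=
  Finset.univ.filter fun i => s.nat 2 i ≠ 0

end Semantics

/-- Every real number has size one: arithmetic on the reals has unit cost. -/
def unitSize (_ : ℝ) : ℕ := 1

/-- The size of a rational number: the binary lengths of its numerator and its denominator. -/
def bitSize (x : ℚ) : ℕ := Nat.size x.num.natAbs + Nat.size x.den

end KnapExp

set_option linter.unusedSectionVars false

namespace KnapExp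

/-! ### Sizes and costs -/

/-! Fix a natural number `N ≥ 1/ε`. The computed query set is the union of two sets, each at most as
large as any feasible query set; hence the factor two.

The first set serves condition (1). Profits are rounded up to `v i = ⌈2nN p i / p_max⌉`, and a
dynamic program finds the least weight for every pair of a scaled profit and a number of nontrivial
items. Let `V` be the largest scaled profit of a packing, and let `A` have the fewest nontrivial
items among packings of scaled profit at least `V - n`. Rounding adds at most one unit per item, so
every packing of profit `p*` competes with `A`. A feasible query set contains the nontrivial items
of such a packing, so `A` has no more of them than it. The profit lost is at most `2n` units of
`p_max / (2nN)`, that is, at most `p*/N` (`scaling`).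

The second set serves condition (2). For a price `λ` per unit of capacity, weak duality bounds what
the unqueried nontrivial items can contribute by `λB + ∑ max (U i - λ w i) 0`. If `Q'` is feasible,
the knapsack problem on the nontrivial items outside `Q'` with profits `U` has value at most `p*`,
so some price, zero or the density of an item, has dual bound at most `2p*` (`exists_multiplier`).
At this price, at most as many queries of items with the highest scores `U i - λ w i` do at least as
well (`exists_threshold`). Hence it suffices to try `(n+1)²` pairs of a price and a rank and to keep
one with the fewest queries among those whose dual bound meets a budget. As `p*` is unknown, the
budget is `p_max V / (nN)`, which lies between `2p*` and `3p*`. Then `U_P(Q) ≤ p(P) + 3p* ≤ 4p*`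
(`sum_upper_le`). `Computes.good` combines both sets.

For the running time, `Ends` is a Hoare-style predicate that counts steps and keeps every stored
value below one size bound `S`. Field elements enter only through `SizeBound`, so one proof covers
both cost models. -/

/-- A subadditive size `h` of field elements that is equivalent to `sz`. -/
structure SizeBound {K : Type} [Field K] (sz h : K → ℕ) : Prop where
  add : ∀ x y, h (x + y) ≤ h x + h y + 1
  sub : ∀ x y, h (x - y) ≤ h x + h y + 1
  mul : ∀ x y, h (x * y) ≤ h x + h y + 1
  div : ∀ x y, h (x / y) ≤ h x + h y + 1
  natCast : ∀ m : ℕ, h (m : K) ≤ Nat.size m + 1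
  le_sz : ∀ x, h x ≤ sz x
  sz_le : ∀ x, sz x ≤ 2 * h x

theorem size_mul_le (a b : ℕ) : Nat.size (a * b) ≤ Nat.size a + Nat.size b := by
  rw [Nat.size_le, pow_add]
  exact Nat.mul_lt_mul'' (Nat.lt_size_self a) (Nat.lt_size_self b)

theorem size_add_le (a b : ℕ) : Nat.size (a + b) ≤ Nat.size a + Nat.size b + 1 := by
  rw [Nat.size_le]
  have ha := Nat.lt_size_self a
  have hb := Nat.lt_size_self b
  have h1 : 2 ^ a.size ≤ 2 ^ (a.size + b.size) := Nat.pow_le_pow_right (by norm_num) (by omega)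
  have h2 : 2 ^ b.size ≤ 2 ^ (a.size + b.size) := Nat.pow_le_pow_right (by norm_num) (by omega)
  rw [pow_succ]
  omega

theorem size_le_self (a : ℕ) : Nat.size a ≤ a := Nat.size_le.2 Nat.lt_two_pow_self

theorem sizeBound_unitSize : SizeBound unitSize unitSize := by
  constructor <;> intros <;> simp [unitSize]

/-- The binary length of the larger one of numerator and denominator. -/
def heightSize (x : ℚ) : ℕ := Nat.size (max x.num.natAbs x.den)

theorem size_two_mul_mul_le (a b c : ℕ) (h : c ≤ 2 * (a * b)) :
    Nat.size c ≤ Nat.size a + Nat.size b + 1 := by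
  rw [Nat.size_le]
  have := Nat.mul_lt_mul'' (Nat.lt_size_self a) (Nat.lt_size_self b)
  rw [← pow_add] at this
  rw [pow_succ]
  omega

/-- The reduced numerator and denominator divide those of any other representation, so an unreduced
fraction already bounds the height. -/
theorem heightSize_le_of_eq_divInt {x : ℚ} {a : ℤ} {b c d : ℕ} (hb : b ≠ 0)
    (hx : x = (a : ℚ) / (b : ℚ))
    (ha : a.natAbs ≤ 2 * (c * d)) (hb' : b ≤ 2 * (c * d)) :
    heightSize x ≤ Nat.size c + Nat.size d + 1 := by
  apply size_two_mul_mul_le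
  have hx' : x = Rat.divInt a b := by rw [hx, Rat.divInt_eq_div]; simp
  have hb0 : (b : ℤ) ≠ 0 := by exact_mod_cast hb
  have h1 : x.den ∣ b := by
    have := Rat.den_dvd a b
    rw [← hx'] at this
    exact_mod_cast this
  have h2 : x.num ∣ a := by
    rw [hx']; exact Rat.num_dvd a hb0
  refine max_le ?_ ((Nat.le_of_dvd (Nat.pos_of_ne_zero hb) h1).trans hb')
  rcases eq_or_ne a 0 with rfl | ha0
  -- Divisibility bounds nothing when the numerator is zero, but then `x = 0`.
  · simp at h2; rw [hx]; simp
  · exact (Nat.le_of_dvd (Int.natAbs_pos.2 ha0) (Int.natAbs_dvd_natAbs.2 h2)).trans ha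

/-- `bitSize` itself is not subadditive up to a constant: adding `1/d` to an integer counts the
length of `d` twice. The height is, and it differs from `bitSize` by a factor of at most two. -/
theorem sizeBound_bitSize : SizeBound bitSize heightSize := by
  have hmul : ∀ x y : ℚ, heightSize (x * y) ≤ heightSize x + heightSize y + 1 := by
    intro x y
    refine heightSize_le_of_eq_divInt (a := x.num * y.num) (b := x.den * y.den)
      (by simp) ?_ ?_ ?_
    · conv_lhs => rw [← Rat.num_div_den x, ← Rat.num_div_den y]
      push_cast
      rw [div_mul_div_comm]
    · rw [Int.natAbs_mul]
      have := Nat.mul_le_mul (le_max_left x.num.natAbs x.den) (le_max_left y.num.natAbs y.den)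
      omega
    · have := Nat.mul_le_mul (le_max_right x.num.natAbs x.den) (le_max_right y.num.natAbs y.den)
      omega
  have hadd : ∀ x y : ℚ, heightSize (x + y) ≤ heightSize x + heightSize y + 1 := by
    intro x y
    refine heightSize_le_of_eq_divInt (a := x.num * y.den + y.num * x.den) (b := x.den * y.den)
      (by simp) ?_ ?_ ?_
    · have hx : (x.den : ℚ) ≠ 0 := by simp
      have hy : (y.den : ℚ) ≠ 0 := by simp
      conv_lhs => rw [← Rat.num_div_den x, ← Rat.num_div_den y]
      push_cast
      field_simp
    · refine (Int.natAbs_add_le _ _).trans ?_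
      rw [Int.natAbs_mul, Int.natAbs_mul]
      simp only [Int.natAbs_natCast]
      have h1 := Nat.mul_le_mul (le_max_left x.num.natAbs x.den) (le_max_right y.num.natAbs y.den)
      have h2 := Nat.mul_le_mul (le_max_left y.num.natAbs y.den) (le_max_right x.num.natAbs x.den)
      rw [mul_comm (max y.num.natAbs _)] at h2
      omega
    · have := Nat.mul_le_mul (le_max_right x.num.natAbs x.den) (le_max_right y.num.natAbs y.den)
      omega
  have hneg : ∀ x : ℚ, heightSize (-x) = heightSize x := by
    intro x; simp [heightSize]
  have hinv : ∀ x : ℚ, heightSize x⁻¹ ≤ heightSize x := by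
    intro x
    apply Nat.size_le_size
    rcases eq_or_ne x 0 with rfl | hx
    · simp
    · rw [max_comm x.num.natAbs]
      apply max_le_max
      · rw [Rat.num_inv, Int.natAbs_mul]
        have : x.num ≠ 0 := by simpa using hx
        simp [Int.natAbs_sign, this]
      · simp [Rat.den_inv, hx]
  refine ⟨hadd, ?_, hmul, ?_, ?_, ?_, ?_⟩
  · intro x y
    rw [sub_eq_add_neg, ← hneg y]; exact hadd _ _
  · intro x y
    rw [div_eq_mul_inv]
    have := hmul x y⁻¹
    have := hinv y
    omega
  · intro m
    have : max m 1 ≤ 2 * (m + 1) := by omega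
    simp only [heightSize, Rat.num_natCast, Int.natAbs_natCast, Rat.den_natCast]
    rw [Nat.size_le]
    have := Nat.lt_size_self m
    rw [pow_succ]
    omega
  · intro x
    unfold heightSize bitSize
    rcases max_cases x.num.natAbs x.den with h | h <;> rw [h.1] <;> omega
  · intro x
    have h1 := Nat.size_le_size (le_max_left x.num.natAbs x.den)
    have h2 := Nat.size_le_size (le_max_right x.num.natAbs x.den)
    unfold heightSize bitSize
    omega

/-- Length of an expression, with constants in unary. -/
def NatExpr.len : NatExpr → ℕ
  | .const k => k + 1
  | .load _ i => i.len + 1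
  | .add e f => e.len + f.len + 1
  | .sub e f => e.len + f.len + 1
  | .mul e f => e.len + f.len + 1
  | .div e f => e.len + f.len + 1

/-- Length of an expression, with constants in unary. -/
def NumExpr.len : NumExpr → ℕ
  | .ofNat e => e.len + 1
  | .load _ i => i.len + 1
  | .add e f => e.len + f.len + 1
  | .sub e f => e.len + f.len + 1
  | .mul e f => e.len + f.len + 1
  | .div e f => e.len + f.len + 1

/-- Length of a test, with constants in unary. -/
def Test.len : Test → ℕ
  | .natLe e f => e.len + f.len + 1
  | .numLe e f => e.len + f.len + 1
  | .not b => b.len + 1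
  | .and b c => b.len + c.len + 1

section Costs

variable {K : Type} [Field K] {sz h : K → ℕ} {S : ℕ}

/-- All cells of the memory have size at most `S`. -/
def Bdd (h : K → ℕ) (S : ℕ) (s : State K) : Prop :=
  (∀ a j, Nat.size (s.nat a j) ≤ S) ∧ ∀ a j, h (s.num a j) ≤ S

/-- Every operation gives a size of at most the sum of the sizes of its arguments plus one, so sizes
grow linearly with the length. Constants count in unary to fit this bound. -/
theorem NatExpr.size_eval_le {s : State K} (hs : ∀ a j, Nat.size (s.nat a j) ≤ S) (e : NatExpr) :
    Nat.size (e.eval s) ≤ e.len * (S + 1) := by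
  induction e with
  | const k =>
    simp only [eval, len]
    have := size_le_self k
    nlinarith
  | load a i ih =>
    simp only [eval, len]
    have := hs a (i.eval s)
    nlinarith
  | add e f he hf =>
    simp only [eval, len]
    have := size_add_le (e.eval s) (f.eval s)
    nlinarith
  | sub e f he hf =>
    simp only [eval, len]
    have := Nat.size_le_size (Nat.sub_le (e.eval s) (f.eval s))
    nlinarith
  | mul e f he hf =>
    simp only [eval, len]
    have := size_mul_le (e.eval s) (f.eval s)
    nlinarith
  | div e f he hf =>
    simp only [eval, len]
    have := Nat.size_le_size (Nat.div_le_self (e.eval s) (f.eval s))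
    nlinarith

theorem NumExpr.size_eval_le (H : SizeBound sz h) {s : State K} (hs : Bdd h S s) (e : NumExpr) :
    h (e.eval s) ≤ e.len * (S + 1) := by
  induction e with
  | ofNat e =>
    simp only [eval, len]
    have := H.natCast (e.eval s)
    have := NatExpr.size_eval_le hs.1 e
    nlinarith
  | load a i =>
    simp only [eval, len]
    have := hs.2 a (i.eval s)
    nlinarith
  | add e f he hf =>
    simp only [eval, len]
    have := H.add (e.eval s) (f.eval s)
    nlinarith
  | sub e f he hf =>
    simp only [eval, len]
    have := H.sub (e.eval s) (f.eval s)
    nlinarith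
  | mul e f he hf =>
    simp only [eval, len]
    have := H.mul (e.eval s) (f.eval s)
    nlinarith
  | div e f he hf =>
    simp only [eval, len]
    have := H.div (e.eval s) (f.eval s)
    nlinarith

/-- The cost sums the sizes of all subexpressions. With `l` fixed through the induction, they share
the bound `key`. The factor two is not needed here; it makes the bound agree with that for field
elements, where `sz ≤ 2 * h`. -/
theorem NatExpr.cost_le {s : State K} (hs : ∀ a j, Nat.size (s.nat a j) ≤ S) {l : ℕ} (e : NatExpr)
    (hl : e.len ≤ l) : e.cost s ≤ e.len * (1 + 2 * (l * (S + 1))) := by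
  have key : ∀ g : NatExpr, g.len ≤ l → Nat.size (g.eval s) ≤ l * (S + 1) := fun g hg =>
    (g.size_eval_le hs).trans (Nat.mul_le_mul_right _ hg)
  induction e with
  | const k =>
    have := key _ hl
    simp only [eval, len, cost] at *
    nlinarith
  | load a i ih =>
    have h1 := key _ hl
    simp only [len, cost] at *
    have := ih (by omega)
    nlinarith
  | add e f he hf =>
    have h1 := key _ hl
    simp only [len, cost] at *
    have := he (by omega)
    have := hf (by omega)
    nlinarith
  | sub e f he hf =>
    have h1 := key _ hl
    simp only [len, cost] at *
    have := he (by omega)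
    have := hf (by omega)
    nlinarith
  | mul e f he hf =>
    have h1 := key _ hl
    simp only [len, cost] at *
    have := he (by omega)
    have := hf (by omega)
    nlinarith
  | div e f he hf =>
    have h1 := key _ hl
    simp only [len, cost] at *
    have := he (by omega)
    have := hf (by omega)
    nlinarith

theorem NumExpr.cost_le (H : SizeBound sz h) {s : State K} (hs : Bdd h S s) {l : ℕ} (e : NumExpr)
    (hl : e.len ≤ l) : e.cost sz s ≤ e.len * (1 + 2 * (l * (S + 1))) := by
  have key : ∀ g : NumExpr, g.len ≤ l → sz (g.eval s) ≤ 2 * (l * (S + 1)) := fun g hg =>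
    (H.sz_le _).trans
      (Nat.mul_le_mul_left _ ((g.size_eval_le H hs).trans (Nat.mul_le_mul_right _ hg)))
  induction e with
  | ofNat e =>
    have h1 := key _ hl
    simp only [len, cost] at *
    have := NatExpr.cost_le hs.1 (l := l) e (by omega)
    nlinarith
  | load a i =>
    have h1 := key _ hl
    simp only [len, cost] at *
    have := NatExpr.cost_le hs.1 (l := l) i (by omega)
    nlinarith
  | add e f he hf =>
    have h1 := key _ hl
    simp only [len, cost] at *
    have := he (by omega)
    have := hf (by omega)
    nlinarith
  | sub e f he hf =>
    have h1 := key _ hl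
    simp only [len, cost] at *
    have := he (by omega)
    have := hf (by omega)
    nlinarith
  | mul e f he hf =>
    have h1 := key _ hl
    simp only [len, cost] at *
    have := he (by omega)
    have := hf (by omega)
    nlinarith
  | div e f he hf =>
    have h1 := key _ hl
    simp only [len, cost] at *
    have := he (by omega)
    have := hf (by omega)
    nlinarith

theorem Test.cost_le (H : SizeBound sz h) {s : State K} (hs : Bdd h S s) {l : ℕ} (b : Test)
    (hl : b.len ≤ l) : b.cost sz s ≤ b.len * (1 + 2 * (l * (S + 1))) := by
  induction b with
  | natLe e f =>
    simp only [len, cost] at *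
    have := NatExpr.cost_le hs.1 (l := l) e (by omega)
    have := NatExpr.cost_le hs.1 (l := l) f (by omega)
    nlinarith
  | numLe e f =>
    simp only [len, cost] at *
    have := NumExpr.cost_le H hs (l := l) e (by omega)
    have := NumExpr.cost_le H hs (l := l) f (by omega)
    nlinarith
  | not b ih =>
    simp only [len, cost] at *
    have := ih (by omega)
    nlinarith
  | and b c hb hc =>
    simp only [len, cost] at *
    have := hb (by omega)
    have := hc (by omega)
    nlinarith

end Costs

/-! ### Total correctness with step counts -/

/-- A bound for the cost of a step whose expressions have length at most `l`, in a memory all cells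
of which have size at most `S`. -/
def stepCost (l S : ℕ) : ℕ := l * (1 + 2 * (l * (S + 1)))

section Ends

variable {K : Type} [Field K] [LinearOrder K] {sz h : K → ℕ} {S l : ℕ}

/-- Started in `s`, the program halts after at most `k` steps, in a memory with cells of size at
most `S` that satisfies `Q`. -/
def Ends (sz h : K → ℕ) (S l k : ℕ) (c : Cmd) (s : State K) (Q : State K → Prop) : Prop :=
  ∃ t s', Exec sz c s t s' ∧ t ≤ k * stepCost l S ∧ Bdd h S s' ∧ Q s'

theorem Ends.mono {k k' : ℕ} {c : Cmd} {s : State K} {Q Q' : State K → Prop}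
    (hc : Ends sz h S l k c s Q) (hk : k ≤ k') (hQ : ∀ s', Bdd h S s' → Q s' → Q' s') :
    Ends sz h S l k' c s Q' := by
  obtain ⟨t, s', he, ht, hb, hq⟩ := hc
  exact ⟨t, s', he, ht.trans (Nat.mul_le_mul_right _ hk), hb, hQ s' hb hq⟩

/-- The run of the second command is the postcondition of the first, so proofs execute the program
symbolically without naming intermediate assertions. -/
theorem Ends.seq {k k' : ℕ} {c d : Cmd} {s : State K} {Q : State K → Prop}
    (hc : Ends sz h S l k c s fun s' => Bdd h S s' → Ends sz h S l k' d s' Q) :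
    Ends sz h S l (k + k') (.seq c d) s Q := by
  obtain ⟨t, s', he, ht, hb, hq⟩ := hc
  obtain ⟨t', s'', he', ht', hb', hq'⟩ := hq hb
  exact ⟨t + t', s'', .seq he he', by rw [add_mul]; omega, hb', hq'⟩

theorem Ends.skip {s : State K} {Q : State K → Prop} (hl : 0 < l) (hs : Bdd h S s) (hQ : Q s) :
    Ends sz h S l 1 .skip s Q := by
  refine ⟨1, s, .skip s, ?_, hs, hQ⟩
  unfold stepCost
  nlinarith [Nat.zero_le (l * (2 * (l * (S + 1))))]

theorem Bdd.writeNat {s : State K} (hs : Bdd h S s) {a j v : ℕ} (hv : Nat.size v ≤ S) :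
    Bdd h S (s.writeNat a j v) := by
  refine ⟨fun a' j' => ?_, hs.2⟩
  simp only [State.writeNat, Function.update_apply]
  split_ifs with h1
  · simp only [Function.update_apply]
    split_ifs
    · exact hv
    · exact hs.1 _ _
  · exact hs.1 _ _

theorem Bdd.writeNum {s : State K} (hs : Bdd h S s) {a j : ℕ} {v : K} (hv : h v ≤ S) :
    Bdd h S (s.writeNum a j v) := by
  refine ⟨hs.1, fun a' j' => ?_⟩
  simp only [State.writeNum, Function.update_apply]
  split_ifs with h1
  · simp only [Function.update_apply]
    split_ifs
    · exact hv
    · exact hs.2 _ _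
  · exact hs.2 _ _

/-- Only the stored value must have size at most `S`; intermediate values are controlled by the
length of the expression. Thus sizes cannot accumulate from step to step. -/
theorem Ends.setNat {a : ℕ} {i e : NatExpr} {s : State K} {Q : State K → Prop}
    (hl : i.len + e.len + 1 ≤ l) (hs : Bdd h S s) (hv : Nat.size (e.eval s) ≤ S)
    (hQ : Q (s.writeNat a (i.eval s) (e.eval s))) :
    Ends sz h S l 1 (.setNat a i e) s Q := by
  refine ⟨_, _, .setNat a i e s, ?_, hs.writeNat hv, hQ⟩
  have h1 := NatExpr.cost_le hs.1 (l := l) i (by omega)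
  have h2 := NatExpr.cost_le hs.1 (l := l) e (by omega)
  have h3 := Nat.mul_le_mul_right (1 + 2 * (l * (S + 1))) hl
  unfold stepCost
  nlinarith

theorem Ends.setNum (H : SizeBound sz h) {a : ℕ} {i : NatExpr} {e : NumExpr} {s : State K}
    {Q : State K → Prop}
    (hl : i.len + e.len + 1 ≤ l) (hs : Bdd h S s) (hv : h (e.eval s) ≤ S)
    (hQ : Q (s.writeNum a (i.eval s) (e.eval s))) :
    Ends sz h S l 1 (.setNum a i e) s Q := by
  refine ⟨_, _, .setNum a i e s, ?_, hs.writeNum hv, hQ⟩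
  have h1 := NatExpr.cost_le hs.1 (l := l) i (by omega)
  have h2 := NumExpr.cost_le H hs (l := l) e (by omega)
  have h3 := Nat.mul_le_mul_right (1 + 2 * (l * (S + 1))) hl
  unfold stepCost
  nlinarith

theorem Test.cost_le_stepCost (H : SizeBound sz h) {s : State K} (hs : Bdd h S s) {b : Test}
    (hl : b.len ≤ l) : b.cost sz s ≤ stepCost l S :=
  (Test.cost_le H hs b hl).trans (Nat.mul_le_mul_right _ hl)

theorem Ends.ite (H : SizeBound sz h) {k : ℕ} {b : Test} {c d : Cmd} {s : State K}
    {Q : State K → Prop} (hl : b.len ≤ l) (hs : Bdd h S s)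
    (hc : b.eval s = true → Ends sz h S l k c s Q)
    (hd : b.eval s = false → Ends sz h S l k d s Q) :
    Ends sz h S l (k + 1) (.ite b c d) s Q := by
  have hb := Test.cost_le_stepCost H hs hl
  cases hbs : b.eval s
  · obtain ⟨t, s', he, ht, hb', hq⟩ := hd hbs
    exact ⟨_, s', .ite_false hbs he, by rw [add_mul]; omega, hb', hq⟩
  · obtain ⟨t, s', he, ht, hb', hq⟩ := hc hbs
    exact ⟨_, s', .ite_true hbs he, by rw [add_mul]; omega, hb', hq⟩

/-- The register `r`: cell `r` of the array `3` of natural numbers. -/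
abbrev reg (r : ℕ) : NatExpr := .load 3 (.const r)

/-- Write the register `r`. -/
abbrev setReg (r : ℕ) (e : NatExpr) : Cmd := .setNat 3 (.const r) e

/-- For all values of the register `r` from `0` to `bnd - 1` do `c`. -/
def forLoop (r : ℕ) (bnd : NatExpr) (c : Cmd) : Cmd :=
  .seq (setReg r (.const 0))
    (.loop (.not (.natLe bnd (reg r))) (.seq c (setReg r (.add (reg r) (.const 1)))))

/-- `Inv i` speaks of a memory whose counter has already been set to `i`, and the body must leave
the counter alone. A round takes `k` steps plus a test and an increment; the last `2` pays for the
initialization and the failing test. -/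
theorem Ends.forLoop (H : SizeBound sz h) {r m k : ℕ} {bnd : NatExpr} {c : Cmd} {s : State K}
    {Q : State K → Prop} (Inv : ℕ → State K → Prop)
    (hl : bnd.len + 2 * r + 10 ≤ l) (hs : Bdd h S s) (hm : Nat.size m ≤ S)
    (init : Inv 0 (s.writeNat 3 r 0))
    (hbnd : ∀ i s, Inv i s → bnd.eval s = m)
    (step : ∀ i s, i < m → Bdd h S s → Inv i s → s.nat 3 r = i →
      Ends sz h S l k c s fun s' => s'.nat 3 r = i ∧ Inv (i + 1) (s'.writeNat 3 r (i + 1)))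
    (post : ∀ s, Inv m s → Q s) :
    Ends sz h S l (m * (k + 2) + 2) (forLoop r bnd c) s Q := by
  -- Induction on the number `d` of remaining rounds.
  have main : ∀ d i s, i + d = m → Bdd h S s → Inv i s → s.nat 3 r = i →
      Ends sz h S l (d * (k + 2) + 1)
        (.loop (.not (.natLe bnd (reg r))) (.seq c (setReg r (.add (reg r) (.const 1))))) s Q := by
    intro d
    induction d with
    | zero =>
      intro i s hi hs hI hr
      have hev : (Test.not (.natLe bnd (reg r))).eval s = false := by
        simp [Test.eval, NatExpr.eval, hbnd i s hI, hr, ← hi]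
      refine ⟨_, s, .loop_false hev, ?_, hs, post s (by simpa [← hi] using hI)⟩
      simpa using Test.cost_le_stepCost H hs (b := .not (.natLe bnd (reg r)))
        (l := l) (by simp [Test.len, NatExpr.len]; omega)
    | succ d ih =>
      intro i s hi hs hI hr
      have hev : (Test.not (.natLe bnd (reg r))).eval s = true := by
        simp [Test.eval, NatExpr.eval, hbnd i s hI, hr, ← hi]
      have hbody : Ends sz h S l (k + 1) (.seq c (setReg r (.add (reg r) (.const 1)))) s
          fun s' => Inv (i + 1) s' ∧ s'.nat 3 r = i + 1 := by
        refine Ends.seq ((step i s (by omega) hs hI hr).mono le_rfl ?_)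
        rintro s' - ⟨hr', hI'⟩ hs'
        refine Ends.setNat (by simp [NatExpr.len]; omega) hs' ?_ ?_
        · simp only [NatExpr.eval, hr']
          exact (Nat.size_le_size (by omega)).trans hm
        · simp only [NatExpr.eval, hr']
          exact ⟨hI', by simp [State.writeNat]⟩
      obtain ⟨t, s', he, ht, hb', hq, hr'⟩ := hbody
      obtain ⟨t', s'', he', ht', hb'', hq'⟩ := ih (i + 1) s' (by omega) hb' hq hr'
      refine ⟨_, s'', .loop_true hev he he', ?_, hb'', hq'⟩
      have := Test.cost_le_stepCost H hs (b := .not (.natLe bnd (reg r)))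
        (l := l) (by simp [Test.len, NatExpr.len]; omega)
      nlinarith
  have := Ends.seq (sz := sz) (h := h) (S := S) (l := l) (k := 1) (k' := m * (k + 2) + 1)
    (c := setReg r (.const 0))
    (d := .loop (.not (.natLe bnd (reg r))) (.seq c (setReg r (.add (reg r) (.const 1)))))
    (s := s) (Q := Q) (Ends.setNat (by simp [NatExpr.len]; omega) hs (by simp [NatExpr.eval])
      fun hb => main m 0 _ (by simp) hb init (by simp [NatExpr.eval, State.writeNat]))
  exact this.mono (by omega) fun _ _ => id

end Ends

end KnapExp

namespace KnapExp

/-! ### Querying the items with the highest scores -/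

section Threshold

variable {K : Type} [Field K] [LinearOrder K]

/-- Item `i` comes before item `r` in the order of decreasing scores. -/
def Before (s : ℕ → K) (r i : ℕ) : Prop := ¬ s i ≤ s r ∨ s r ≤ s i ∧ r + 1 ≤ i

instance (s : ℕ → K) (r : ℕ) : DecidablePred (Before s r) := fun _ =>
  inferInstanceAs (Decidable (_ ∨ _))

/-- Ties are broken by the index, which gives a strict total order: passing to the next item changes
the number of predecessors by one. -/
theorem before_iff (s : ℕ → K) (r i : ℕ) :
    Before s r i ↔ toLex (s r, r) < toLex (s i, i) := by
  rw [Prod.Lex.toLex_lt_toLex]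
  unfold Before
  simp only [not_le]
  constructor
  · rintro (h | ⟨h, h'⟩)
    · exact .inl h
    · rcases h.lt_or_eq with h | h
      · exact .inl h
      · exact .inr ⟨h, h'⟩
  · rintro (h | ⟨h, h'⟩)
    · exact .inl h
    · exact .inr ⟨h.le, h'⟩

theorem Before.le {s : ℕ → K} {r i : ℕ} (h : Before s r i) : s r ≤ s i := by
  rcases h with h | h
  · exact (not_le.1 h).le
  · exact h.1

theorem le_of_not_before {s : ℕ → K} {r i : ℕ} (h : ¬ Before s r i) : s i ≤ s r := by
  by_contra h'
  exact h (.inl h')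

/-- A set of items with the highest scores leaves a sum at most that of any other set of the same
cardinality. -/
theorem sum_sdiff_le_of_card_eq [IsStrictOrderedRing K] {E G R : Finset ℕ} {g : ℕ → K} {τ : K}
    (hG : G ⊆ E) (hR : R ⊆ E) (hcard : G.card = R.card) (h1 : ∀ i ∈ G, τ ≤ g i)
    (h2 : ∀ i ∈ E, i ∉ G → g i ≤ τ) :
    ∑ i ∈ E \ G, g i ≤ ∑ i ∈ E \ R, g i := by
  have e1 := Finset.sum_sdiff hG (f := g)
  have e2 := Finset.sum_sdiff hR (f := g)
  have e3 := Finset.sum_inter_add_sum_sdiff G R g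
  have e4 := Finset.sum_inter_add_sum_sdiff R G g
  rw [Finset.inter_comm] at e4
  have c := Finset.card_sdiff_comm hcard
  have l1 : ∑ i ∈ R \ G, g i ≤ (R \ G).card • τ := Finset.sum_le_card_nsmul _ _ _ fun i hi => by
    rw [Finset.mem_sdiff] at hi
    exact h2 i (hR hi.1) hi.2
  have l2 : (G \ R).card • τ ≤ ∑ i ∈ G \ R, g i := Finset.card_nsmul_le_sum _ _ _ fun i hi => by
    rw [Finset.mem_sdiff] at hi
    exact h1 i hi.1
  rw [c] at l2
  linarith

/-- An exchange argument: a prefix of the order by scores of the same cardinality as `R` leaves no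
larger sum of positive parts. If fewer than `|R|` queries already catch all positive scores, the
dummy item `n` of score zero serves as threshold. -/
theorem exists_threshold [IsStrictOrderedRing K] {n : ℕ} {E R : Finset ℕ} {s : ℕ → K}
    (hE : E ⊆ Finset.range n) (hn : s n = 0) (hR : R ⊆ E) :
    ∃ r ≤ n, (E.filter (Before s r)).card ≤ R.card ∧
      ∑ i ∈ E.filter (fun i => ¬ Before s r i), max (s i) 0 ≤ ∑ i ∈ E \ R, max (s i) 0 := by
  -- All of `E` lies below `n`, so inside `E` exactly the items of positive score come before `n`.
  by_cases hpos : (E.filter (Before s n)).card ≤ R.card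
  · refine ⟨n, le_rfl, hpos, ?_⟩
    rw [Finset.sum_eq_zero]
    · exact Finset.sum_nonneg fun i _ => le_max_right _ _
    · intro i hi
      have := le_of_not_before (Finset.mem_filter.1 hi).2
      rw [hn] at this
      exact max_eq_right this
  · have hcE : R.card < E.card :=
      (not_le.1 hpos).trans_le (Finset.card_le_card (Finset.filter_subset _ _))
    have hEne : E.Nonempty := Finset.card_pos.1 (by omega)
    obtain ⟨r₀, hr₀, htop⟩ := E.exists_max_image (fun i => toLex (s i, i)) hEne
    have hA : (E.filter fun r => (E.filter (Before s r)).card ≤ R.card).Nonempty := by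
      refine ⟨r₀, Finset.mem_filter.2 ⟨hr₀, ?_⟩⟩
      rw [Finset.card_eq_zero.2]
      · omega
      · refine Finset.filter_eq_empty_iff.2 fun i hi hb => ?_
        rw [before_iff] at hb
        exact absurd (htop i hi) (not_le.2 hb)
    -- The lowest item with at most `|R|` predecessors. It has exactly `|R|`, since its successor in
    -- the order has only one predecessor more.
    obtain ⟨r, hr, hmin⟩ := Finset.exists_min_image _ (fun i => toLex (s i, i)) hA
    rw [Finset.mem_filter] at hr
    have heq : (E.filter (Before s r)).card = R.card := by
      refine le_antisymm hr.2 (not_lt.1 fun hlt => ?_)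
      rcases (E.filter fun i => toLex (s i, i) < toLex (s r, r)).eq_empty_or_nonempty with h0 | h0
      · have : E ⊆ insert r (E.filter (Before s r)) := by
          intro i hi
          rw [Finset.mem_insert, Finset.mem_filter, before_iff]
          rcases lt_trichotomy (toLex (s i, i)) (toLex (s r, r)) with h | h | h
          · exact absurd h (Finset.filter_eq_empty_iff.1 h0 hi)
          · exact .inl (congrArg (fun x => (ofLex x).2) h)
          · exact .inr ⟨hi, h⟩
        have := (Finset.card_le_card this).trans (Finset.card_insert_le _ _)
        omega
      · obtain ⟨r', hr', hmax⟩ := Finset.exists_max_image _ (fun i => toLex (s i, i)) h0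
        rw [Finset.mem_filter] at hr'
        have hsub : E.filter (Before s r') ⊆ insert r (E.filter (Before s r)) := by
          intro i hi
          rw [Finset.mem_filter, before_iff] at hi
          rw [Finset.mem_insert, Finset.mem_filter, before_iff]
          rcases lt_trichotomy (toLex (s i, i)) (toLex (s r, r)) with h | h | h
          · exact absurd (hmax i (Finset.mem_filter.2 ⟨hi.1, h⟩)) (not_le.2 hi.2)
          · exact .inl (congrArg (fun x => (ofLex x).2) h)
          · exact .inr ⟨hi.1, h⟩
        have := (Finset.card_le_card hsub).trans (Finset.card_insert_le _ _)
        exact absurd (hmin r' (Finset.mem_filter.2 ⟨hr'.1, by omega⟩)) (not_le.2 hr'.2)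
    refine ⟨r, (Finset.mem_range.1 (hE hr.1)).le, heq.le, ?_⟩
    rw [Finset.filter_not]
    refine sum_sdiff_le_of_card_eq (τ := max (s r) 0) (Finset.filter_subset _ _) hR heq ?_ ?_
    · intro i hi
      exact max_le_max_right _ (Finset.mem_filter.1 hi).2.le
    · intro i hi hi'
      refine max_le_max_right _ (le_of_not_before fun hb => hi' (Finset.mem_filter.2 ⟨hi, hb⟩))

/-- Weak duality for the fractional knapsack problem, with a multiplier that is the density of an
item (or zero): its value is at most twice that of the knapsack problem. -/
theorem exists_multiplier [IsStrictOrderedRing K] {n B : ℕ} {E : Finset ℕ} {w : ℕ → ℕ} {U : ℕ → K}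
    {o : K} (hE : E ⊆ Finset.range n) (hU : ∀ i ∈ E, 0 ≤ U i) (hw : ∀ i ∈ E, w i ≤ B)
    (hn : U n = 0) (ho : ∀ A ⊆ E, ∑ i ∈ A, w i ≤ B → ∑ i ∈ A, U i ≤ o) :
    ∃ j ≤ n, U j / w j * B + ∑ i ∈ E, max (U i - U j / w j * w i) 0 ≤ 2 * o := by
  have ho0 : 0 ≤ o := by simpa using ho ∅ (by simp) (by simp)
  -- The prefixes of the order by density that fit, with densities cross-multiplied to allow zero
  -- weights. A largest one is what the greedy algorithm packs.
  let 𝓖 := E.powerset.filter fun G =>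
    (∀ i ∈ G, ∀ k ∈ E, k ∉ G → U k * w i ≤ U i * w k) ∧ ∑ i ∈ G, w i ≤ B
  have h𝓖 : 𝓖.Nonempty := ⟨∅, by simp [𝓖]⟩
  obtain ⟨G, hG, hmax⟩ := 𝓖.exists_max_image Finset.card h𝓖
  simp only [𝓖, Finset.mem_filter, Finset.mem_powerset] at hG hmax
  obtain ⟨hGE, hup, hGB⟩ := hG
  rcases (E \ G).eq_empty_or_nonempty with h0 | h0
  · have hEG : E = G := Finset.Subset.antisymm (Finset.sdiff_eq_empty_iff_subset.1 h0) hGE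
    -- Everything fits, so capacity is free: the dummy item `n` gives price zero.
    refine ⟨n, le_rfl, ?_⟩
    simp only [hn, zero_div, zero_mul, sub_zero, zero_add]
    have h1 := ho G hGE hGB
    rw [hEG, Finset.sum_congr rfl fun i hi => max_eq_left (hU i (hGE hi))]
    linarith
  -- A weightless item could be added to `G`, so the densities outside `G` are genuine quotients.
  · have hwpos : ∀ j ∈ E \ G, w j ≠ 0 := by
      intro j hj hwj
      rw [Finset.mem_sdiff] at hj
      have := hmax (insert j G) ⟨Finset.insert_subset hj.1 hGE, ?_, ?_⟩
      · rw [Finset.card_insert_of_notMem hj.2] at this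
        omega
      · intro i hi k hk hkG
        rw [Finset.mem_insert, not_or] at hkG
        rcases Finset.mem_insert.1 hi with rfl | hi
        · rw [hwj, Nat.cast_zero, mul_zero]
          exact mul_nonneg (hU _ hj.1) (Nat.cast_nonneg _)
        · exact hup i hi k hk hkG.2
      · rwa [Finset.sum_insert hj.2, hwj, zero_add]
    obtain ⟨j, hj, hjmax⟩ := Finset.exists_max_image _ (fun i => U i / (w i : K)) h0
    have hj' := Finset.mem_sdiff.1 hj
    have hwK : ∀ k ∈ E \ G, (0 : K) < w k := fun k hk =>
      Nat.cast_pos.2 (Nat.pos_of_ne_zero (hwpos k hk))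
    -- The densest remaining item `j` would extend the prefix, so it cannot fit.
    have hover : B < ∑ i ∈ G, w i + w j := by
      by_contra hle
      have := hmax (insert j G) ⟨Finset.insert_subset hj'.1 hGE, ?_, ?_⟩
      · rw [Finset.card_insert_of_notMem hj'.2] at this
        omega
      · intro i hi k hk hkG
        rw [Finset.mem_insert, not_or] at hkG
        rcases Finset.mem_insert.1 hi with rfl | hi
        · have hk' : k ∈ E \ G := Finset.mem_sdiff.2 ⟨hk, hkG.2⟩
          have := hjmax k hk'
          rwa [div_le_div_iff₀ (hwK k hk') (hwK i hj)] at this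
        · exact hup i hi k hk hkG.2
      · rw [Finset.sum_insert hj'.2]
        omega
    refine ⟨j, (Finset.mem_range.1 (hE hj'.1)).le, ?_⟩
    set lam : K := U j / w j with hlam
    have hlj : lam * w j = U j := div_mul_cancel₀ _ (hwK j hj).ne'
    have hin : ∀ i ∈ G, max (U i - lam * w i) 0 = U i - lam * w i := by
      intro i hi
      refine max_eq_left (sub_nonneg.2 ?_)
      rw [hlam, div_mul_eq_mul_div, div_le_iff₀ (hwK j hj)]
      exact hup i hi j hj'.1 hj'.2
    have hout : ∀ i ∈ E \ G, max (U i - lam * w i) 0 = 0 := by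
      intro i hi
      refine max_eq_right (sub_nonpos.2 ?_)
      have := hjmax i hi
      rwa [div_le_iff₀ (hwK i hi)] at this
    -- At the density of `j`, the dual value is `U(G) + lam * (B - w(G)) ≤ U(G) + U j`. Both `G` and
    -- `{j}` are packings, whence `2 * o`.
    rw [← Finset.sum_sdiff hGE, Finset.sum_congr rfl hin, Finset.sum_congr rfl hout,
      Finset.sum_const_zero, zero_add, Finset.sum_sub_distrib, ← Finset.mul_sum]
    have h1 := ho G hGE hGB
    have h2 := ho {j} (Finset.singleton_subset_iff.2 hj'.1) (by simpa using hw j hj'.1)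
    rw [Finset.sum_singleton] at h2
    have h3 : (B : K) ≤ ∑ i ∈ G, (w i : K) + w j := by exact_mod_cast hover.le
    have hl0 : 0 ≤ lam := div_nonneg (hU j hj'.1) (Nat.cast_nonneg _)
    have := mul_le_mul_of_nonneg_left h3 hl0
    rw [mul_add, hlj] at this
    linarith

end Threshold

/-! ### The dynamic program -/

/-- The minimum weight of a set of the first `i` items with total key `x`; a value larger than `B`
stands for "at least that large". -/
def dp (c w : ℕ → ℕ) (B : ℕ) : ℕ → ℕ → ℕ
  | 0, x => if x = 0 then 0 else B + 1
  | i + 1, x =>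
    if c i ≤ x ∧ dp c w B i (x - c i) + w i ≤ dp c w B i x then dp c w B i (x - c i) + w i
    else dp c w B i x

theorem dp_succ_le (c w : ℕ → ℕ) (B i x : ℕ) : dp c w B (i + 1) x ≤ dp c w B i x := by
  rw [dp]
  split_ifs with h
  · exact h.2
  · exact le_rfl

theorem dp_succ_of_lt {c w : ℕ → ℕ} {B i x : ℕ} (h : dp c w B (i + 1) x < dp c w B i x) :
    c i ≤ x ∧ dp c w B (i + 1) x = dp c w B i (x - c i) + w i := by
  rw [dp] at *
  split_ifs at * with h'
  · exact ⟨h'.1, rfl⟩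
  · exact absurd h (lt_irrefl _)

theorem dp_le_succ (c w : ℕ → ℕ) (B i x : ℕ) : dp c w B i x ≤ B + 1 := by
  induction i generalizing x with
  | zero => rw [dp]; split_ifs <;> omega
  | succ i ih => exact (dp_succ_le c w B i x).trans (ih x)

theorem dp_sum_le (c w : ℕ → ℕ) (B i : ℕ) (A : Finset ℕ) (hA : A ⊆ Finset.range i) :
    dp c w B i (∑ k ∈ A, c k) ≤ ∑ k ∈ A, w k := by
  induction i generalizing A with
  | zero =>
    obtain rfl : A = ∅ := by simpa using hA
    simp [dp]
  | succ i ih =>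
    by_cases hi : i ∈ A
    · have hs : A.erase i ⊆ Finset.range i := by
        intro k hk
        rw [Finset.mem_erase] at hk
        have := Finset.mem_range.1 (hA hk.2)
        exact Finset.mem_range.2 (by omega)
      have := ih _ hs
      rw [← Finset.add_sum_erase A c hi, ← Finset.add_sum_erase A w hi, dp,
        Nat.add_sub_cancel_left]
      split_ifs with h
      · omega
      · have : c i ≤ c i + ∑ k ∈ A.erase i, c k := by omega
        simp only [this, true_and] at h
        omega
    · refine (dp_succ_le _ _ _ _ _).trans (ih A fun k hk => ?_)
      have := Finset.mem_range.1 (hA hk)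
      have : k ≠ i := fun h => hi (h ▸ hk)
      exact Finset.mem_range.2 (by omega)

end KnapExp

namespace KnapExp

/-- An entry of at most `B` cannot stem from the sentinel `B + 1`, so it is attained. Together with
`dp_sum_le`, the keys with entry at most `B` are exactly those of packings. -/
theorem exists_of_dp_le {c w : ℕ → ℕ} {B i x : ℕ} (h : dp c w B i x ≤ B) :
    ∃ A ⊆ Finset.range i, ∑ k ∈ A, c k = x ∧ ∑ k ∈ A, w k = dp c w B i x := by
  induction i generalizing x with
  | zero =>
    rw [dp] at h
    split_ifs at h with hx
    · exact ⟨∅, by simp, by simp [hx], by simp [dp, hx]⟩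
    · omega
  | succ i ih =>
    have hsub : Finset.range i ⊆ Finset.range (i + 1) := Finset.range_subset_range.2 (by omega)
    rcases (dp_succ_le c w B i x).lt_or_eq with hlt | heq
    · obtain ⟨h1, h2⟩ := dp_succ_of_lt hlt
      obtain ⟨A, hA, hc, hw⟩ := ih (x := x - c i) (by omega)
      have hi : i ∉ A := fun hi => by simpa using hA hi
      refine ⟨insert i A, Finset.insert_subset (by simp) (hA.trans hsub), ?_, ?_⟩
      · rw [Finset.sum_insert hi, hc]; omega
      · rw [Finset.sum_insert hi, hw, h2, add_comm]
    · obtain ⟨A, hA, hc, hw⟩ := ih (x := x) (by omega)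
      exact ⟨A, hA.trans hsub, hc, by rw [hw, heq]⟩

/-! ### Quality of the packing found and of the candidates for the second set -/

section Core

variable {K : Type} [Field K] [LinearOrder K]

/-- The nontrivial items. -/
def nontriv (n : ℕ) (L U : ℕ → K) : Finset ℕ := (Finset.range n).filter fun i => ¬ U i ≤ L i

/-- The keys of the dynamic program: the scaled profit and a flag for nontrivial items. -/
def itemKey (n : ℕ) (v : ℕ → ℕ) (L U : ℕ → K) (i : ℕ) : ℕ :=
  v i * (n + 1) + if U i ≤ L i then 0 else 1

/-- At most `n` flags are summed, so nothing carries into the profit part: division by `n + 1`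
recovers the scaled profit, and the remainder counts nontrivial items. -/
theorem sum_itemKey {n : ℕ} {v : ℕ → ℕ} {L U : ℕ → K} {A : Finset ℕ} (hA : A ⊆ Finset.range n) :
    ∑ i ∈ A, itemKey n v L U i = (∑ i ∈ A, v i) * (n + 1) + (A ∩ nontriv n L U).card := by
  simp only [itemKey, Finset.sum_add_distrib, Finset.sum_mul]
  congr 1
  have : A ∩ nontriv n L U = A.filter fun i => ¬ U i ≤ L i := by
    ext i
    simp only [nontriv, Finset.mem_inter, Finset.mem_filter]
    exact ⟨fun h => ⟨h.1, h.2.2⟩, fun h => ⟨h.1, hA h.1, h.2⟩⟩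
  rw [this, Finset.card_filter]
  exact Finset.sum_congr rfl fun i _ => by split_ifs <;> rfl

theorem card_inter_nontriv_le (n : ℕ) (L U : ℕ → K) (A : Finset ℕ) :
    (A ∩ nontriv n L U).card ≤ n := by
  refine (Finset.card_le_card (Finset.inter_subset_right.trans (Finset.filter_subset _ _))).trans ?_
  simp

theorem sum_itemKey_div {n : ℕ} {v : ℕ → ℕ} {L U : ℕ → K} {A : Finset ℕ}
    (hA : A ⊆ Finset.range n) :
    (∑ i ∈ A, itemKey n v L U i) / (n + 1) = ∑ i ∈ A, v i := by
  have := card_inter_nontriv_le n L U A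
  rw [sum_itemKey hA, add_comm, Nat.add_mul_div_right _ _ (by omega), Nat.div_eq_of_lt (by omega),
    zero_add]

theorem sum_itemKey_mod {n : ℕ} {v : ℕ → ℕ} {L U : ℕ → K} {A : Finset ℕ}
    (hA : A ⊆ Finset.range n) :
    (∑ i ∈ A, itemKey n v L U i) % (n + 1) = (A ∩ nontriv n L U).card := by
  have := card_inter_nontriv_le n L U A
  rw [sum_itemKey hA, add_comm, Nat.add_mul_mod_self_right, Nat.mod_eq_of_lt (by omega)]

theorem sum_itemKey_lt {n M : ℕ} {v : ℕ → ℕ} {L U : ℕ → K} {A : Finset ℕ}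
    (hv : ∀ i < n, v i ≤ M) (hA : A ⊆ Finset.range n) :
    ∑ i ∈ A, itemKey n v L U i < (n * M + 1) * (n + 1) := by
  have h1 := card_inter_nontriv_le n L U A
  have h2 : ∑ i ∈ A, v i ≤ n * M := by
    calc ∑ i ∈ A, v i ≤ ∑ _i ∈ A, M :=
          Finset.sum_le_sum fun i hi => hv i (Finset.mem_range.1 (hA hi))
      _ = A.card * M := by simp
      _ ≤ n * M := Nat.mul_le_mul_right _ (by simpa using Finset.card_le_card hA)
  rw [sum_itemKey hA]
  nlinarith

variable [IsStrictOrderedRing K]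

/-- What the search in the table of the dynamic program finds. -/
theorem scaling {n B N pm xl xb : ℕ} {w v : ℕ → ℕ} {p L U : ℕ → K} {A Po : Finset ℕ} {opt : K}
    (hN : 0 < N) (hw : ∀ i < n, w i ≤ B) (hp : ∀ i < n, 0 ≤ p i)
    (hpm : ∀ i < n, p i ≤ p pm) (hpmn : 0 < n → pm < n)
    (hv1 : ∀ i < n, ((2 * n * N : ℕ) : K) * p i ≤ v i * p pm)
    (hv2 : ∀ i < n, ∀ u, v i = u + 1 → u * p pm < ((2 * n * N : ℕ) : K) * p i)
    (hvM : ∀ i < n, v i ≤ 2 * n * N)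
    (hxl : dp (itemKey n v L U) w B n xl ≤ B)
    (hlast : ∀ x < (n * (2 * n * N) + 1) * (n + 1), dp (itemKey n v L U) w B n x ≤ B → x ≤ xl)
    (hxb : xl / (n + 1) ≤ xb / (n + 1) + n)
    (hmin : ∀ x < (n * (2 * n * N) + 1) * (n + 1), dp (itemKey n v L U) w B n x ≤ B →
      xl / (n + 1) ≤ x / (n + 1) + n → xb % (n + 1) ≤ x % (n + 1))
    (hA : A ⊆ Finset.range n) (hAc : ∑ i ∈ A, itemKey n v L U i = xb)
    (hopt : ∀ P ⊆ Finset.range n, ∑ i ∈ P, w i ≤ B → ∑ i ∈ P, p i ≤ opt)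
    (hPo : Po ⊆ Finset.range n) (hPow : ∑ i ∈ Po, w i ≤ B) (hPop : ∑ i ∈ Po, p i = opt) :
    N * opt ≤ N * ∑ i ∈ A, p i + opt ∧
    (∀ P ⊆ Finset.range n, ∑ i ∈ P, w i ≤ B → ∑ i ∈ P, p i = opt →
      (A ∩ nontriv n L U).card ≤ (P ∩ nontriv n L U).card) ∧
    2 * opt ≤ p pm * (xl / (n + 1) : ℕ) / (n * N : ℕ) ∧
    p pm * (xl / (n + 1) : ℕ) / (n * N : ℕ) ≤ 3 * opt := by
  rcases Nat.eq_zero_or_pos n with rfl | hn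
  · have ho : opt = 0 := by
      obtain rfl : Po = ∅ := by simpa using hPo
      simpa using hPop.symm
    obtain rfl : A = ∅ := by simpa using hA
    simp [ho]
  obtain ⟨A', hA', hA'c, hA'w⟩ := exists_of_dp_le hxl
  have hA'w' : ∑ i ∈ A', w i ≤ B := by rw [hA'w]; exact hxl
  have hvm : xl / (n + 1) = ∑ i ∈ A', v i := by rw [← hA'c, sum_itemKey_div hA']
  have hvb : xb / (n + 1) = ∑ i ∈ A, v i := by rw [← hAc, sum_itemKey_div hA]
  have hpm0 : 0 ≤ p pm := hp _ (hpmn hn)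
  have hpmo : p pm ≤ opt := by
    simpa using hopt {pm} (by simpa using hpmn hn) (by simpa using hw _ (hpmn hn))
  -- The two directions of the rounding: scaled profits never underestimate, and they overestimate
  -- by at most one unit per item.
  have hup : ∀ P ⊆ Finset.range n,
      ((2 * n * N : ℕ) : K) * ∑ i ∈ P, p i ≤ (∑ i ∈ P, v i : ℕ) * p pm := by
    intro P hP
    rw [Finset.mul_sum, Nat.cast_sum, Finset.sum_mul]
    exact Finset.sum_le_sum fun i hi => hv1 i (Finset.mem_range.1 (hP hi))
  have hlow : ∀ P ⊆ Finset.range n,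
      ((∑ i ∈ P, v i : ℕ) : K) * p pm ≤ ((2 * n * N : ℕ) : K) * ∑ i ∈ P, p i + n * p pm := by
    intro P hP
    rw [Finset.mul_sum, Nat.cast_sum, Finset.sum_mul]
    calc ∑ i ∈ P, (v i : K) * p pm ≤ ∑ i ∈ P, (((2 * n * N : ℕ) : K) * p i + p pm) := by
          refine Finset.sum_le_sum fun i hi => ?_
          have hi' := Finset.mem_range.1 (hP hi)
          cases hu : v i with
          | zero =>
            have := mul_nonneg (Nat.cast_nonneg (α := K) (2 * n * N)) (hp i hi')
            rw [Nat.cast_zero, zero_mul]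
            linarith
          | succ u =>
            have := hv2 i hi' u hu
            push_cast at this ⊢
            linarith
      _ = ∑ i ∈ P, ((2 * n * N : ℕ) : K) * p i + P.card * p pm := by
          rw [Finset.sum_add_distrib, Finset.sum_const, nsmul_eq_mul]
      _ ≤ _ := by
          have : (P.card : K) ≤ n := by
            exact_mod_cast (by simpa using Finset.card_le_card hP)
          have := mul_le_mul_of_nonneg_right this hpm0
          linarith
  -- If all profits vanish, `p pm` cannot be cancelled; then all scaled profits are zero.
  have hv0 : p pm = 0 → ∀ i < n, v i = 0 := by
    intro h0 i hi
    cases hu : v i with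
    | zero => rfl
    | succ u =>
      have h1 := hv2 i hi u hu
      have h2 : p i = 0 := le_antisymm (h0 ▸ hpm i hi) (hp i hi)
      simp [h0, h2] at h1
  have hle : ∀ P ⊆ Finset.range n, ∑ i ∈ P, w i ≤ B → ∑ i ∈ P, v i ≤ xl / (n + 1) := by
    intro P hP hPw
    have := hlast _ (sum_itemKey_lt hvM hP) ((dp_sum_le _ _ _ _ _ hP).trans hPw)
    rw [← sum_itemKey_div (L := L) (U := U) hP]
    exact Nat.div_le_div_right this
  -- Optimal packings pass the relaxed test: rounding can favour `A'` by at most `n` units. This is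
  -- why `n` is subtracted from the best scaled profit.
  have hclose : ∀ P ⊆ Finset.range n, ∑ i ∈ P, p i = opt → xl / (n + 1) ≤ ∑ i ∈ P, v i + n := by
    intro P hP hPp
    rw [hvm]
    rcases hpm0.eq_or_lt with h0 | h0
    · rw [Finset.sum_eq_zero fun i hi => hv0 h0.symm i (Finset.mem_range.1 (hA' hi))]
      omega
    · have h1 := hlow A' hA'
      have h2 := hup P hP
      have h3 := mul_le_mul_of_nonneg_left (hopt A' hA' hA'w')
        (Nat.cast_nonneg (α := K) (2 * n * N))
      rw [hPp] at h2
      have h4 : ((∑ i ∈ A', v i : ℕ) : K) * p pm ≤ ((∑ i ∈ P, v i + n : ℕ) : K) * p pm := by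
        rw [Nat.cast_add, add_mul]
        linarith
      exact_mod_cast le_of_mul_le_mul_right h4 h0
  have hnK : (0 : K) < n := Nat.cast_pos.2 hn
  have hNK : (0 : K) < N := Nat.cast_pos.2 hN
  have hM : ((2 * n * N : ℕ) : K) = 2 * n * N := by push_cast; ring
  have hN1 : (1 : K) ≤ N := by exact_mod_cast hN
  rw [hM] at hup hlow
  have ho0 : 0 ≤ opt := hpm0.trans hpmo
  refine ⟨?_, ?_, ?_, ?_⟩
  -- Two losses of `n` units each, one from rounding and one from the relaxed test, are absorbed by
  -- the factor two in the scale `2nN`.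
  · have h1 := hlow A hA
    have h2 := hup Po hPo
    have h3 : ((∑ i ∈ Po, v i : ℕ) : K) ≤ ((∑ i ∈ A, v i : ℕ) : K) + n := by
      have := (hle Po hPo hPow).trans (hvb ▸ hxb)
      exact_mod_cast this
    have h4 := mul_le_mul_of_nonneg_right h3 hpm0
    rw [hPop] at h2
    have h5 := mul_le_mul_of_nonneg_left hpmo hnK.le
    have h6 : (2 * n) * (N * opt) ≤ (2 * n) * (N * ∑ i ∈ A, p i + opt) := by
      linarith
    exact le_of_mul_le_mul_left h6 (by positivity)
  · intro P hP hPw hPp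
    have := hmin _ (sum_itemKey_lt hvM hP) ((dp_sum_le _ _ _ _ _ hP).trans hPw) (by
      rw [sum_itemKey_div hP]; exact hclose P hP hPp)
    rwa [← hAc, sum_itemKey_mod hA, sum_itemKey_mod hP] at this
  -- Dividing by `nN` instead of the scale `2nN` doubles the estimate of `opt`; the next bound adds
  -- a rounding error of at most `opt / N ≤ opt`.
  · rw [Nat.cast_mul, le_div_iff₀ (by positivity)]
    have h2 := hup Po hPo
    rw [hPop] at h2
    have h3 : ((∑ i ∈ Po, v i : ℕ) : K) ≤ (xl / (n + 1) : ℕ) := by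
      exact_mod_cast hle Po hPo hPow
    have h4 := mul_le_mul_of_nonneg_right h3 hpm0
    linarith
  · rw [Nat.cast_mul, div_le_iff₀ (by positivity), hvm]
    have h1 := hlow A' hA'
    have h3 := mul_le_mul_of_nonneg_left (hopt A' hA' hA'w') (a := 2 * (n : K) * N) (by positivity)
    have h5 := mul_le_mul_of_nonneg_left hpmo hnK.le
    have h6 := mul_le_mul_of_nonneg_left hN1 (mul_nonneg hnK.le ho0)
    linarith

/-- The reduced profit of item `i` when a unit of capacity costs the density of item `j`. -/
def score (w : ℕ → ℕ) (U : ℕ → K) (j i : ℕ) : K := U i - U j / w j * w i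

/-- The reduced profits of the nontrivial items not before `r`, with the cost of the capacity. -/
def remaining (n B : ℕ) (w : ℕ → ℕ) (L U : ℕ → K) (j r : ℕ) : K :=
  U j / w j * B +
    ∑ i ∈ (nontriv n L U).filter (fun i => ¬ Before (score w U j) r i), max (score w U j i) 0

/-- The number of nontrivial items before `r`. -/
def queried (n : ℕ) (w : ℕ → ℕ) (L U : ℕ → K) (j r : ℕ) : ℕ :=
  ((nontriv n L U).filter (Before (score w U j) r)).card

/-- The price comes from duality on the nontrivial items outside `Q`, the rank from the exchange
argument applied to the nontrivial items of `Q`. -/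
theorem exists_candidate {n B : ℕ} {w : ℕ → ℕ} {p L U : ℕ → K} {Q : Finset ℕ} {opt : K}
    (hw : ∀ i < n, w i ≤ B) (hU : ∀ i < n, 0 ≤ U i) (hUn : U n = 0)
    (hwn : w n = 0)
    (hQ : ∀ P ⊆ Finset.range n, ∑ i ∈ P, w i ≤ B →
      ∑ i ∈ P, (if i ∈ Q then p i else U i) ≤ opt) :
    ∃ j ≤ n, ∃ r ≤ n, remaining n B w L U j r ≤ 2 * opt ∧
      queried n w L U j r ≤ (Q ∩ nontriv n L U).card := by
  have hE : nontriv n L U ⊆ Finset.range n := Finset.filter_subset _ _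
  obtain ⟨j, hj, h⟩ := exists_multiplier (n := n) (B := B) (E := nontriv n L U \ Q) (w := w)
    (U := U) (o := opt) (Finset.sdiff_subset.trans hE)
    (fun i hi => hU i (Finset.mem_range.1 (hE (Finset.mem_sdiff.1 hi).1)))
    (fun i hi => hw i (Finset.mem_range.1 (hE (Finset.mem_sdiff.1 hi).1))) hUn (by
      -- Items outside `Q` enter the upper limit with `U`, so the assumption on `Q` bounds the
      -- knapsack problem on them by `opt`.
      intro A hA hAw
      refine le_of_eq_of_le (Finset.sum_congr rfl fun i hi => ?_)
        (hQ A (hA.trans (Finset.sdiff_subset.trans hE)) hAw)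
      rw [if_neg (Finset.mem_sdiff.1 (hA hi)).2])
  obtain ⟨r, hr, h1, h2⟩ := exists_threshold (n := n) (E := nontriv n L U)
    (R := nontriv n L U ∩ Q) (s := score w U j) hE (by simp [score, hUn, hwn])
    Finset.inter_subset_left
  refine ⟨j, hj, r, hr, ?_, by rwa [Finset.inter_comm]⟩
  rw [Finset.sdiff_inter_self_left] at h2
  exact (add_le_add_right h2 _).trans h

/-- Queried and trivial items contribute no more than their profits, which total at most `opt`. Each
remaining item has `U i = λ * w i + score`; summing the first terms over a packing gives at most
`λB`, so the excess is at most the dual bound. -/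
theorem sum_upper_le {n B j r : ℕ} {w : ℕ → ℕ} {p L U : ℕ → K} {Q P : Finset ℕ} {b opt : K}
    (hp : ∀ i < n, 0 ≤ p i) (hpU : ∀ i < n, p i ≤ U i) (hUj : 0 ≤ U j)
    (htriv : ∀ i < n, U i ≤ L i → U i = p i)
    (hQ : (nontriv n L U).filter (Before (score w U j) r) ⊆ Q)
    (hb : remaining n B w L U j r ≤ b)
    (hP : P ⊆ Finset.range n) (hPw : ∑ i ∈ P, w i ≤ B) (hPp : ∑ i ∈ P, p i ≤ opt) :
    ∑ i ∈ P, (if i ∈ Q then p i else U i) ≤ opt + b := by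
  let F := (nontriv n L U).filter fun i => ¬ Before (score w U j) r i
  have hlam : 0 ≤ U j / w j := div_nonneg hUj (Nat.cast_nonneg _)
  have h1 : ∑ i ∈ P, (if i ∈ Q then p i else U i) ≤
      ∑ i ∈ P, p i + ∑ i ∈ P, if i ∈ F then U i else 0 := by
    rw [← Finset.sum_add_distrib]
    refine Finset.sum_le_sum fun i hi => ?_
    have hi' := Finset.mem_range.1 (hP hi)
    have h0 := hp i hi'
    have h0' := h0.trans (hpU i hi')
    by_cases hiQ : i ∈ Q
    · rw [if_pos hiQ]
      split_ifs <;> linarith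
    · rw [if_neg hiQ]
      by_cases hiF : i ∈ F
      · rw [if_pos hiF]; linarith
      · rw [if_neg hiF, add_zero]
        by_cases ht : U i ≤ L i
        · exact (htriv i hi' ht).le
        · have hm : i ∈ nontriv n L U := Finset.mem_filter.2 ⟨hP hi, ht⟩
          have hbf : Before (score w U j) r i := by
            by_contra hbf
            exact hiF (Finset.mem_filter.2 ⟨hm, hbf⟩)
          exact absurd (hQ (Finset.mem_filter.2 ⟨hm, hbf⟩)) hiQ
  have h2 : ∑ i ∈ P, (if i ∈ F then U i else 0) ≤
      ∑ i ∈ P, (U j / w j * w i + if i ∈ F then max (score w U j i) 0 else 0) := by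
    refine Finset.sum_le_sum fun i hi => ?_
    have h3 : 0 ≤ U j / w j * (w i : K) := mul_nonneg hlam (Nat.cast_nonneg _)
    split_ifs
    · have := le_max_left (score w U j i) 0
      rw [score] at this ⊢
      linarith
    · linarith
  rw [Finset.sum_add_distrib, ← Finset.mul_sum] at h2
  simp only [Finset.sum_ite_mem] at h1 h2
  have h3 : (∑ i ∈ P, (w i : K)) ≤ B := by exact_mod_cast hPw
  have h4 := mul_le_mul_of_nonneg_left h3 hlam
  have h5 : ∑ i ∈ P ∩ F, max (score w U j i) 0 ≤ ∑ i ∈ F, max (score w U j i) 0 :=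
    Finset.sum_le_sum_of_subset_of_nonneg Finset.inter_subset_right fun _ _ _ => le_max_right _ _
  have h6 : U j / w j * B + ∑ i ∈ F, max (score w U j i) 0 ≤ b := hb
  linarith

end Core

end KnapExp

namespace KnapExp

/-! ### The program -/

/-- The number of items. -/
abbrev nE : NatExpr := .load 0 (.const 0)

/-- The number of items plus one. -/
abbrev nE₁ : NatExpr := .add nE (.const 1)

/-- The capacity. -/
abbrev capE : NatExpr := .load 0 (.const 1)

/-- The scaled maximum profit. -/
abbrev scaleE : NatExpr := .mul (.mul (.const 2) nE) (reg 0)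

/-- The remainder of a division. -/
abbrev modE (a b : NatExpr) : NatExpr := .sub a (.mul (.div a b) b)

/-- Find an item of maximum profit. -/
def maxCmd : Cmd :=
  forLoop 5 nE (.ite (.not (.numLe (.load 0 (reg 5)) (.load 0 (reg 1)))) (setReg 1 (reg 5)) .skip)

/-- Compute the keys of the items. -/
def keyCmd : Cmd :=
  forLoop 5 nE
    (.seq (.setNat 4 (reg 5) (.const 0))
      (.seq
        (forLoop 6 scaleE
          (.ite (.not (.numLe (.mul (.ofNat scaleE) (.load 0 (reg 5)))
              (.mul (.ofNat (reg 6)) (.load 0 (reg 1)))))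
            (.setNat 4 (reg 5) (.add (reg 6) (.const 1))) .skip))
        (.ite (.numLe (.load 2 (reg 5)) (.load 1 (reg 5)))
          (.setNat 4 (reg 5) (.mul (.load 4 (reg 5)) nE₁))
          (.setNat 4 (reg 5) (.add (.mul (.load 4 (reg 5)) nE₁) (.const 1))))))

/-- Fill in the table of the dynamic program. -/
def tableCmd : Cmd :=
  forLoop 5 (.mul nE₁ (reg 2))
    (.ite (.natLe (.add (reg 5) (.const 1)) (reg 2))
      (.ite (.natLe (reg 5) (.const 0)) (.setNat 5 (reg 5) (.const 0))
        (.setNat 5 (reg 5) (.add capE (.const 1))))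
      (.ite (.and (.natLe (.load 4 (.sub (.div (reg 5) (reg 2)) (.const 1))) (modE (reg 5) (reg 2)))
          (.natLe (.add (.load 5 (.sub (.sub (reg 5) (reg 2))
              (.load 4 (.sub (.div (reg 5) (reg 2)) (.const 1)))))
            (.load 1 (.sub (.div (reg 5) (reg 2)) (.const 1))))
            (.load 5 (.sub (reg 5) (reg 2)))))
        (.setNat 5 (reg 5) (.add (.load 5 (.sub (.sub (reg 5) (reg 2))
              (.load 4 (.sub (.div (reg 5) (reg 2)) (.const 1)))))
            (.load 1 (.sub (.div (reg 5) (reg 2)) (.const 1)))))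
        (.setNat 5 (reg 5) (.load 5 (.sub (reg 5) (reg 2))))))

/-- Find the largest key of a packing. -/
def lastCmd : Cmd :=
  forLoop 5 (reg 2)
    (.ite (.natLe (.load 5 (.add (.mul nE (reg 2)) (reg 5))) capE) (setReg 3 (reg 5)) .skip)

/-- Find the key of a packing of almost maximum profit with the fewest nontrivial items. -/
def bestCmd : Cmd :=
  .seq (setReg 4 (reg 3))
    (forLoop 5 (reg 2)
      (.ite (.and (.natLe (.load 5 (.add (.mul nE (reg 2)) (reg 5))) capE)
          (.and (.natLe (.div (reg 3) nE₁) (.add (.div (reg 5) nE₁) nE))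
            (.natLe (modE (reg 5) nE₁) (modE (reg 4) nE₁))))
        (setReg 4 (reg 5)) .skip))

/-- Mark the items of a packing with the key found. -/
def traceCmd : Cmd :=
  forLoop 5 nE
    (.ite (.not (.natLe
        (.load 5 (.add (.mul (.sub nE (.add (reg 5) (.const 1))) (reg 2)) (reg 4)))
        (.load 5 (.add (.mul (.add (.sub nE (.add (reg 5) (.const 1))) (.const 1)) (reg 2))
          (reg 4)))))
      (.seq (.setNat 6 (.sub nE (.add (reg 5) (.const 1))) (.const 1))
        (setReg 4 (.sub (reg 4) (.load 4 (.sub nE (.add (reg 5) (.const 1)))))))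
      .skip)

/-- The item that gives the price of a unit of capacity. -/
abbrev priceE : NatExpr := .div (reg 5) nE₁

/-- The item up to which the others are queried. -/
abbrev rankE : NatExpr := modE (reg 5) nE₁

/-- The score of an item. -/
abbrev scoreE (i : NatExpr) : NumExpr :=
  .sub (.load 2 i) (.mul (.div (.load 2 priceE) (.ofNat (.load 1 priceE))) (.ofNat (.load 1 i)))

/-- Does the item in register `6` come before the item `rankE`? -/
abbrev beforeT : Test :=
  .not (.and (.numLe (scoreE (reg 6)) (scoreE rankE))
    (.not (.and (.numLe (scoreE rankE) (scoreE (reg 6)))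
      (.natLe (.add rankE (.const 1)) (reg 6)))))

/-- Count the items queried by a candidate and sum up the scores of the other ones. -/
def evalCmd : Cmd :=
  forLoop 6 nE
    (.ite (.numLe (.load 2 (reg 6)) (.load 1 (reg 6))) .skip
      (.ite beforeT (setReg 9 (.add (reg 9) (.const 1)))
        (.ite (.numLe (.ofNat (.const 0)) (scoreE (reg 6)))
          (.setNum 3 (.const 0) (.add (.load 3 (.const 0)) (scoreE (reg 6)))) .skip)))

/-- Find the best candidate. -/
def searchCmd : Cmd :=
  .seq (setReg 7 nE) (.seq (setReg 8 (.add (.mul nE nE₁) nE))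
    (forLoop 5 (.mul nE₁ nE₁)
      (.seq (setReg 9 (.const 0)) (.seq (.setNum 3 (.const 0) (.ofNat (.const 0)))
        (.seq evalCmd
          (.ite (.and (.numLe
              (.add (.mul (.div (.load 2 priceE) (.ofNat (.load 1 priceE))) (.ofNat capE))
                (.load 3 (.const 0)))
              (.div (.mul (.load 0 (reg 1)) (.ofNat (.div (reg 3) nE₁))) (.ofNat (.mul nE (reg 0)))))
              (.natLe (reg 9) (reg 7)))
            (.seq (setReg 7 (reg 9)) (setReg 8 (reg 5))) .skip))))))

/-- Write the items to be queried. -/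
def outCmd : Cmd :=
  .seq (setReg 5 (reg 8))
    (forLoop 6 nE
      (.ite (.and (.not (.numLe (.load 2 (reg 6)) (.load 1 (reg 6))))
          (.not (.and (.natLe (.load 6 (reg 6)) (.const 0)) (.not beforeT))))
        (.setNat 2 (reg 6) (.const 1)) .skip))

/-- The algorithm for the accuracy `1 / N`. -/
def algorithm (N : ℕ) : Cmd :=
  .seq (setReg 0 (.const N)) (.seq maxCmd
    (.seq (setReg 2 (.mul (.add (.mul nE scaleE) (.const 1)) nE₁))
      (.seq keyCmd (.seq tableCmd (.seq lastCmd (.seq bestCmd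
        (.seq traceCmd (.seq searchCmd outCmd))))))))

/-! ### Verification -/

section Frame

variable {K : Type}

@[simp] theorem nat_writeNat (s : State K) (a j v b : ℕ) :
    (s.writeNat a j v).nat b = if b = a then Function.update (s.nat a) j v else s.nat b := by
  simp [State.writeNat, Function.update_apply]

@[simp] theorem num_writeNat (s : State K) (a j v : ℕ) : (s.writeNat a j v).num = s.num := rfl

@[simp] theorem num_writeNum (s : State K) (a j : ℕ) (v : K) (b : ℕ) :
    (s.writeNum a j v).num b = if b = a then Function.update (s.num a) j v else s.num b := by
  simp [State.writeNum, Function.update_apply]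

@[simp] theorem nat_writeNum (s : State K) (a j : ℕ) (v : K) :
    (s.writeNum a j v).nat = s.nat := rfl

/-- The memory `s'` differs from `s` only in the arrays `A` and the registers `R`, and in the array
`3` of field elements. -/
structure Frame (A R : List ℕ) (s s' : State K) : Prop where
  nat : ∀ a, a ∉ A → a ≠ 3 → s'.nat a = s.nat a
  reg : ∀ r, r ∉ R → s'.nat 3 r = s.nat 3 r
  num : ∀ a, a ≠ 3 → s'.num a = s.num a

variable {A A' R R' : List ℕ} {s s' s'' : State K}

theorem Frame.refl (A R : List ℕ) (s : State K) : Frame A R s s :=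
  ⟨fun _ _ _ => rfl, fun _ _ => rfl, fun _ _ => rfl⟩

theorem Frame.trans (h : Frame A R s s') (h' : Frame A R s' s'') : Frame A R s s'' :=
  ⟨fun a h1 h2 => (h'.nat a h1 h2).trans (h.nat a h1 h2),
    fun r h1 => (h'.reg r h1).trans (h.reg r h1),
    fun a h1 => (h'.num a h1).trans (h.num a h1)⟩

theorem Frame.mono (h : Frame A R s s') (hA : A ⊆ A') (hR : R ⊆ R') : Frame A' R' s s' :=
  ⟨fun a h1 h2 => h.nat a (fun h3 => h1 (hA h3)) h2, fun r h1 => h.reg r fun h3 => h1 (hR h3),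
    h.num⟩

theorem Frame.writeReg (h : Frame A R s s') {r v : ℕ} (hr : r ∈ R) :
    Frame A R s (s'.writeNat 3 r v) := by
  refine ⟨fun a h1 h2 => ?_, fun r' h1 => ?_, fun a h1 => ?_⟩
  · simpa [h2] using h.nat a h1 h2
  · have : r' ≠ r := fun e => h1 (e ▸ hr)
    simpa [Function.update_apply, this] using h.reg r' h1
  · exact h.num a h1

theorem Frame.writeNat (h : Frame A R s s') {a j v : ℕ} (ha : a ∈ A) (ha3 : a ≠ 3) :
    Frame A R s (s'.writeNat a j v) := by
  refine ⟨fun b h1 h2 => ?_, fun r' h1 => ?_, fun a h1 => ?_⟩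
  · have : b ≠ a := fun e => h1 (e ▸ ha)
    simpa [this] using h.nat b h1 h2
  · simpa [ha3.symm] using h.reg r' h1
  · exact h.num a h1

theorem Frame.writeNum (h : Frame A R s s') {j : ℕ} {v : K} :
    Frame A R s (s'.writeNum 3 j v) := by
  refine ⟨h.nat, h.reg, fun a h1 => ?_⟩
  simpa [h1] using h.num a h1

/-- The input: the number of items, the capacity, the accuracy, the weights, the profits and the
limits of the intervals. -/
structure Data (K : Type) where
  n : ℕ
  B : ℕ
  N : ℕ
  w : ℕ → ℕ
  p : ℕ → K
  L : ℕ → K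
  U : ℕ → K

/-- The memory holds the input. -/
structure Holds (C : Data K) (s : State K) : Prop where
  n : s.nat 0 0 = C.n
  B : s.nat 0 1 = C.B
  N : s.nat 3 0 = C.N
  w : s.nat 1 = C.w
  p : s.num 0 = C.p
  L : s.num 1 = C.L
  U : s.num 2 = C.U

theorem Holds.frame {C : Data K} (h : Holds C s) (hF : Frame A R s s') (h0 : 0 ∉ A) (h1 : 1 ∉ A)
    (hR : 0 ∉ R) : Holds C s' := by
  have e0 := hF.nat 0 h0 (by decide)
  have e1 := hF.nat 1 h1 (by decide)
  have e2 := hF.reg 0 hR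
  have e3 := hF.num 0 (by decide)
  have e4 := hF.num 1 (by decide)
  have e5 := hF.num 2 (by decide)
  exact ⟨by rw [e0, h.n], by rw [e0, h.B], by rw [e2, h.N], by rw [e1, h.w], by rw [e3, h.p],
    by rw [e4, h.L], by rw [e5, h.U]⟩

/-- The scaled maximum profit. -/
def Data.M (C : Data K) : ℕ := 2 * C.n * C.N

/-- The number of keys. -/
def Data.D (C : Data K) : ℕ := (C.n * C.M + 1) * (C.n + 1)

/-- A bound for the natural numbers that occur. -/
def Data.big (C : Data K) : ℕ := (C.n + 1) * C.D + C.B + 1 + C.N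

theorem Data.D_pos (C : Data K) : 0 < C.D := by unfold Data.D; positivity

theorem Data.n_lt_D (C : Data K) : C.n < C.D := by
  unfold Data.D
  nlinarith [Nat.zero_le (C.n * C.M * (C.n + 1))]

theorem Data.M_lt_D (C : Data K) : C.M < C.D := by
  unfold Data.D
  rcases Nat.eq_zero_or_pos C.n with h | h
  · simp [Data.M, h]
  · nlinarith [Nat.zero_le (C.n * C.M * C.n), Nat.mul_le_mul_right C.M h]

theorem Data.D_le_big (C : Data K) : C.D ≤ C.big := by
  unfold Data.big
  nlinarith [Nat.zero_le (C.n * C.D)]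

end Frame

/-! ### Verification of the phases of the program -/

section Phases

variable {K : Type} [Field K] [LinearOrder K] {sz h : K → ℕ} {S l : ℕ} {C : Data K} {s : State K}

theorem maxCmd_ends (H : SizeBound sz h) (hl : 1000 ≤ l) (hS : ∀ m ≤ C.big, Nat.size m ≤ S)
    (hs : Bdd h S s) (hC : Holds C s) (h1 : s.nat 3 1 = 0) :
    Ends sz h S l (C.n * (2 + 2) + 2) maxCmd s fun s' => Frame [] [1, 5] s s' ∧
      (∀ i < C.n, C.p i ≤ C.p (s'.nat 3 1)) ∧ (0 < C.n → s'.nat 3 1 < C.n) := by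
  refine Ends.forLoop H (m := C.n) (k := 2) (fun i s' => Frame [] [1, 5] s s' ∧
    (∀ k < i, C.p k ≤ C.p (s'.nat 3 1)) ∧ (0 < C.n → s'.nat 3 1 < C.n)) (by simp [NatExpr.len]; omega) hs
    (hS _ (C.n_lt_D.le.trans C.D_le_big)) ⟨(Frame.refl _ _ _).writeReg (by simp), by simp, ?_⟩ ?_ ?_ ?_
  · simp [h1]
  · rintro i s' ⟨hF, -⟩
    exact (hC.frame hF (by simp) (by simp) (by simp)).n
  · rintro i s' hi hs' ⟨hF, hp, hn⟩ hr
    have hC' := hC.frame hF (by simp) (by simp) (by simp)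
    refine Ends.ite H (by simp [Test.len, NumExpr.len, NatExpr.len]; omega) hs' ?_ ?_
    · intro hb
      simp [Test.eval, NumExpr.eval, NatExpr.eval, hr, hC'.p] at hb
      refine Ends.setNat (by simp [NatExpr.len]; omega) hs' (by simpa [NatExpr.eval] using hs'.1 _ _) ?_
      simp only [NatExpr.eval, hr]
      refine ⟨by simp [hr], (hF.writeReg (by simp)).writeReg (by simp), ?_, ?_⟩
      · intro k hk
        simp
        rcases Nat.lt_succ_iff_lt_or_eq.1 hk with hk | rfl
        · exact (hp k hk).trans hb.le
        · exact le_rfl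
      · simpa using fun _ => hi
    · intro hb
      simp [Test.eval, NumExpr.eval, NatExpr.eval, hr, hC'.p] at hb
      refine Ends.skip (by omega) hs' ⟨hr, hF.writeReg (by simp), ?_, by simpa using hn⟩
      intro k hk
      simp
      rcases Nat.lt_succ_iff_lt_or_eq.1 hk with hk | rfl
      · exact hp k hk
      · exact hb
  · rintro s' ⟨hF, hp, hn⟩
    exact ⟨hF, hp, hn⟩

end Phases

end KnapExp

namespace KnapExp

section Phases

variable {K : Type} [Field K] [LinearOrder K] {sz h : K → ℕ} {S l : ℕ} {C : Data K} {s : State K}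

/-- The least `v ≤ m` with `a ≤ v * b`, if there is one. -/
def scaledProfit (a b : K) : ℕ → ℕ
  | 0 => 0
  | m + 1 => if a ≤ m * b then scaledProfit a b m else m + 1

theorem scaledProfit_le (a b : K) (m : ℕ) : scaledProfit a b m ≤ m := by
  induction m with
  | zero => rfl
  | succ m ih => rw [scaledProfit]; split_ifs <;> omega

theorem lt_of_scaledProfit_eq {a b : K} {m u : ℕ} (hu : scaledProfit a b m = u + 1) :
    u * b < a := by
  induction m with
  | zero => simp [scaledProfit] at hu
  | succ m ih =>
    rw [scaledProfit] at hu
    split_ifs at hu with h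
    · exact ih hu
    · obtain rfl : m = u := by omega
      exact not_le.1 h

theorem le_scaledProfit_mul {a b : K} {m : ℕ} (h : a ≤ m * b) : a ≤ scaledProfit a b m * b := by
  induction m with
  | zero => exact h
  | succ m ih =>
    rw [scaledProfit]
    split_ifs with h'
    · exact ih h'
    · exact h

/-- The scaled profits. -/
def Data.v (C : Data K) (pm i : ℕ) : ℕ := scaledProfit ((C.M : K) * C.p i) (C.p pm) C.M

/-- The keys of the items. -/
def Data.key (C : Data K) (pm : ℕ) : ℕ → ℕ := itemKey C.n (C.v pm) C.L C.U

theorem Data.v_le (C : Data K) (pm i : ℕ) : C.v pm i ≤ C.M := scaledProfit_le _ _ _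

theorem Data.key_lt {C : Data K} {pm i : ℕ} (hi : i < C.n) : C.key pm i < C.D := by
  have := sum_itemKey_lt (L := C.L) (U := C.U) (M := C.M) (A := {i}) (v := C.v pm) (n := C.n)
    (fun i _ => C.v_le pm i) (by simpa using hi)
  simpa [Data.key, Data.D] using this

/-- The machine cannot round a field element to a natural number, so the ceiling is found by linear
search: the cell becomes `u + 1` whenever `u` units are not enough. Afterwards it is overwritten by
the key. -/
theorem keyCmd_ends {pm : ℕ} (H : SizeBound sz h) (hl : 1000 ≤ l)
    (hS : ∀ m ≤ C.big, Nat.size m ≤ S)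
    (hs : Bdd h S s) (hC : Holds C s) (h1 : s.nat 3 1 = pm) :
    Ends sz h S l (C.n * (C.M * 4 + 7) + 2) keyCmd s fun s' => Frame [4] [5, 6] s s' ∧
      ∀ i < C.n, s'.nat 4 i = C.key pm i := by
  have hMS : ∀ m ≤ C.M, Nat.size m ≤ S :=
    fun m hm => hS _ (hm.trans (C.M_lt_D.le.trans C.D_le_big))
  have hDS : ∀ m < C.D, Nat.size m ≤ S := fun m hm => hS _ (hm.le.trans C.D_le_big)
  refine (Ends.forLoop H (m := C.n) (k := 1 + (C.M * (2 + 2) + 2 + 2)) (fun i s' => Frame [4] [5, 6] s s' ∧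
    ∀ k < i, s'.nat 4 k = C.key pm k) (by simp [NatExpr.len]; omega) hs
    (hDS _ C.n_lt_D) ⟨(Frame.refl _ _ _).writeReg (by simp), by simp⟩ ?_ ?_ ?_).mono (by ring_nf; omega)
      (Q := fun s' => Frame [4] [5, 6] s s' ∧ ∀ i < C.n, s'.nat 4 i = C.key pm i)
      fun _ _ => id
  · rintro i s' ⟨hF, -⟩
    exact (hC.frame hF (by simp) (by simp) (by simp)).n
  · rintro i s' hi hs' ⟨hF, hk⟩ hr
    have hC' := hC.frame hF (by simp) (by simp) (by simp)
    refine Ends.seq (Ends.setNat (by simp [NatExpr.len]; omega) hs' (by simp [NatExpr.eval]) ?_)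
    simp only [NatExpr.eval, hr]
    intro hs1
    refine Ends.seq ((Ends.forLoop H (m := C.M) (k := 2) (fun u s'' => Frame [4] [5, 6] s s'' ∧
      s''.nat 3 5 = i ∧ (∀ k < i, s''.nat 4 k = C.key pm k) ∧
      s''.nat 4 i = scaledProfit ((C.M : K) * C.p i) (C.p pm) u)
      (by simp [NatExpr.len]; omega) hs1 (hMS _ le_rfl)
      ⟨(hF.writeNat (by simp) (by simp)).writeReg (by simp), by simp [hr], ?_, ?_⟩ ?_ ?_ ?_))
    · intro k hki
      have : k ≠ i := by omega
      simpa [this] using hk k hki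
    · simp [scaledProfit]
    · rintro u s'' ⟨hF', -⟩
      have hC'' := hC.frame hF' (by simp) (by simp) (by simp)
      simp [NatExpr.eval, hC''.n, hC''.N, Data.M]
    · rintro u s'' hu hs'' ⟨hF', hr5, hk', hv⟩ hr6
      have hC'' := hC.frame hF' (by simp) (by simp) (by simp)
      have hpm : s''.nat 3 1 = pm := by rw [hF'.reg 1 (by simp), h1]
      have hev : ((Test.not (.numLe (.mul (.ofNat scaleE) (.load 0 (reg 5)))
              (.mul (.ofNat (reg 6)) (.load 0 (reg 1))))).eval s'' = true) ↔
          ¬ (C.M : K) * C.p i ≤ u * C.p pm := by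
        simp [Test.eval, NumExpr.eval, NatExpr.eval, hC''.n, hC''.N, hC''.p, Data.M, hr5, hr6, hpm]
      refine Ends.ite H (by simp [Test.len, NumExpr.len, NatExpr.len]; omega) hs'' ?_ ?_
      · intro hb
        rw [hev] at hb
        refine Ends.setNat (by simp [NatExpr.len]; omega) hs'' ?_ ?_
        · simp only [NatExpr.eval, hr6]
          exact hMS _ hu
        · simp only [NatExpr.eval, hr6, hr5]
          refine ⟨by simp [hr6], (hF'.writeNat (by simp) (by simp)).writeReg (by simp),
            by simp [hr5], ?_, ?_⟩
          · intro k hki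
            have : k ≠ i := by omega
            simpa [this] using hk' k hki
          · simp [scaledProfit, hb]
      · intro hb
        rw [← Bool.not_eq_true, hev, not_not] at hb
        refine Ends.skip (by omega) hs'' ⟨hr6, hF'.writeReg (by simp), by simpa using hr5,
            by simpa using hk', ?_⟩
        simpa [scaledProfit, hb] using hv
    · rintro s'' ⟨hF', hr5, hk', hv⟩ hs''
      have hC'' := hC.frame hF' (by simp) (by simp) (by simp)
      have hkey := C.key_lt (pm := pm) hi
      have hkey' : C.key pm i = C.v pm i * (C.n + 1) + if C.U i ≤ C.L i then 0 else 1 := rfl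
      rw [Data.v, ← hv] at hkey'
      refine (Ends.ite (k := 1) H (by simp [Test.len, NumExpr.len, NatExpr.len]; omega) hs'' ?_ ?_)
      · intro hb
        simp [Test.eval, NumExpr.eval, NatExpr.eval, hr5, hC''.U, hC''.L] at hb
        rw [if_pos hb, add_zero] at hkey'
        refine Ends.setNat (by simp [NatExpr.len]; omega) hs'' ?_ ?_
        · simp only [NatExpr.eval, hr5, hC''.n, ← hkey']
          exact hDS _ hkey
        · simp only [NatExpr.eval, hr5, hC''.n, ← hkey']
          refine ⟨by simp [hr5], (hF'.writeNat (by simp) (by simp)).writeReg (by simp), ?_⟩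
          intro k hki
          rcases Nat.lt_succ_iff_lt_or_eq.1 hki with hki | rfl
          · have : k ≠ i := by omega
            simpa [this] using hk' k hki
          · simp
      · intro hb
        simp [Test.eval, NumExpr.eval, NatExpr.eval, hr5, hC''.U, hC''.L] at hb
        rw [if_neg (not_le.2 hb)] at hkey'
        refine Ends.setNat (by simp [NatExpr.len]; omega) hs'' ?_ ?_
        · simp only [NatExpr.eval, hr5, hC''.n, ← hkey']
          exact hDS _ hkey
        · simp only [NatExpr.eval, hr5, hC''.n, ← hkey']
          refine ⟨by simp [hr5], (hF'.writeNat (by simp) (by simp)).writeReg (by simp), ?_⟩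
          intro k hki
          rcases Nat.lt_succ_iff_lt_or_eq.1 hki with hki | rfl
          · have : k ≠ i := by omega
            simpa [this] using hk' k hki
          · simp
  · exact fun _ => id

/-- A single loop runs over the addresses `i * D + x`. Row `i + 1` reads only row `i`, which lies at
smaller addresses and is therefore complete. -/
theorem tableCmd_ends {pm : ℕ} (H : SizeBound sz h) (hl : 1000 ≤ l)
    (hS : ∀ m ≤ C.big, Nat.size m ≤ S)
    (hs : Bdd h S s) (hC : Holds C s) (h2 : s.nat 3 2 = C.D)
    (h4 : ∀ i < C.n, s.nat 4 i = C.key pm i) :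
    Ends sz h S l ((C.n + 1) * C.D * 5 + 2) tableCmd s fun s' => Frame [5] [5] s s' ∧
      ∀ i ≤ C.n, ∀ x < C.D, s'.nat 5 (i * C.D + x) = dp (C.key pm) C.w C.B i x := by
  have hbig : ∀ m ≤ (C.n + 1) * C.D, Nat.size m ≤ S :=
    fun m hm => hS _ (hm.trans (by unfold Data.big; omega))
  have hDpos := C.D_pos
  refine Ends.forLoop H (m := (C.n + 1) * C.D) (k := 2 + 1) (fun y s' => Frame [5] [5] s s' ∧
    ∀ i, ∀ x < C.D, i * C.D + x < y → s'.nat 5 (i * C.D + x) = dp (C.key pm) C.w C.B i x)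
    (by simp [NatExpr.len]; omega) hs (hbig _ le_rfl)
    ⟨(Frame.refl _ _ _).writeReg (by simp), by simp⟩ ?_ ?_ ?_
  · rintro i s' ⟨hF, -⟩
    have hC' := hC.frame hF (by simp) (by simp) (by simp)
    simp [NatExpr.eval, hC'.n, hF.reg 2, h2]
  · rintro y s' hy hs' ⟨hF, hT⟩ hr
    have hC' := hC.frame hF (by simp) (by simp) (by simp)
    have h2' : s'.nat 3 2 = C.D := by rw [hF.reg 2 (by simp), h2]
    have h4' : ∀ i < C.n, s'.nat 4 i = C.key pm i := by
      rw [hF.nat 4 (by simp) (by simp)]; exact h4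
    obtain ⟨i, x, hx, rfl⟩ : ∃ i x, x < C.D ∧ y = i * C.D + x :=
      ⟨y / C.D, y % C.D, Nat.mod_lt _ hDpos, (Nat.div_add_mod' y C.D).symm⟩
    have hdiv : (i * C.D + x) / C.D = i := by
      rw [add_comm, Nat.add_mul_div_right _ _ hDpos, Nat.div_eq_of_lt hx, zero_add]
    have hin : i ≤ C.n := by
      by_contra hcon
      have := Nat.mul_le_mul_right C.D (show C.n + 1 ≤ i by omega)
      omega
    have fin : ∀ v, v = dp (C.key pm) C.w C.B i x →
        ((s'.writeNat 5 (i * C.D + x) v).nat 3 5 = i * C.D + x ∧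
        Frame [5] [5] s ((s'.writeNat 5 (i * C.D + x) v).writeNat 3 5 (i * C.D + x + 1)) ∧
        ∀ i', ∀ x' < C.D, i' * C.D + x' < i * C.D + x + 1 →
          ((s'.writeNat 5 (i * C.D + x) v).writeNat 3 5 (i * C.D + x + 1)).nat 5
            (i' * C.D + x') = dp (C.key pm) C.w C.B i' x') := by
      rintro v hv
      refine ⟨by simp [hr], (hF.writeNat (by simp) (by simp)).writeReg (by simp), ?_⟩
      intro i' x' hx' hlt
      rcases Nat.lt_succ_iff_lt_or_eq.1 hlt with hlt | heq
      · have : i' * C.D + x' ≠ i * C.D + x := by omega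
        simpa [this] using hT i' x' hx' hlt
      · have e1 : i' = i := by
          have := congrArg (· / C.D) heq
          simp only [hdiv] at this
          rwa [add_comm, Nat.add_mul_div_right _ _ hDpos, Nat.div_eq_of_lt hx', zero_add] at this
        subst e1
        obtain rfl : x' = x := by omega
        simpa using hv
    have hdp : Nat.size (dp (C.key pm) C.w C.B i x) ≤ S :=
      hS _ ((dp_le_succ _ _ _ _ _).trans (by unfold Data.big; omega))
    refine Ends.ite H (by simp [Test.len, NatExpr.len]; omega) hs' ?_ ?_
    · intro hb
      simp [Test.eval, NatExpr.eval, hr, h2'] at hb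
      have hi0 : i = 0 := by
        by_contra hi0
        have := Nat.mul_le_mul_right C.D (Nat.one_le_iff_ne_zero.2 hi0)
        omega
      refine Ends.ite H (by simp [Test.len, NatExpr.len]; omega) hs' ?_ ?_
      · intro hb'
        simp [Test.eval, NatExpr.eval, hr] at hb'
        have hv : 0 = dp (C.key pm) C.w C.B i x := by simp [hi0, hb'.2, dp]
        refine Ends.setNat (by simp [NatExpr.len]; omega) hs' (by simp [NatExpr.eval]) ?_
        simp only [NatExpr.eval, hr]
        exact fin _ hv
      · intro hb'
        have hx0 : x ≠ 0 := by
          simp [Test.eval, NatExpr.eval, hr, hi0] at hb'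
          omega
        have hv : C.B + 1 = dp (C.key pm) C.w C.B i x := by simp [hi0, hx0, dp]
        refine Ends.setNat (by simp [NatExpr.len]; omega) hs' ?_ ?_
        · simp only [NatExpr.eval, hC'.B, hv]
          exact hdp
        · simp only [NatExpr.eval, hr, hC'.B]
          exact fin _ hv
    · intro hb
      simp [Test.eval, NatExpr.eval, hr, h2'] at hb
      obtain ⟨k, rfl⟩ : ∃ k, i = k + 1 := by
        refine Nat.exists_eq_succ_of_ne_zero ?_
        rintro rfl
        omega
      have e1 : (k + 1) * C.D + x - C.D = k * C.D + x := by
        rw [add_mul, one_mul]; omega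
      have e2 : (k + 1) * C.D + x - (k + 1) * C.D = x := by omega
      have hlt1 : k * C.D + x < (k + 1) * C.D + x := by rw [add_mul]; omega
      have hk := h4' k (by omega)
      have t1 := hT k x hx hlt1
      have t2 : C.key pm k ≤ x → s'.nat 5 (k * C.D + x - C.key pm k) =
          dp (C.key pm) C.w C.B k (x - C.key pm k) := by
        intro hle
        have := hT k (x - C.key pm k) (by omega) (by omega)
        rwa [← Nat.add_sub_assoc hle] at this
      have hev : (Test.and (.natLe (.load 4 (.sub (.div (reg 5) (reg 2)) (.const 1)))
            (modE (reg 5) (reg 2)))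
          (.natLe (.add (.load 5 (.sub (.sub (reg 5) (reg 2))
              (.load 4 (.sub (.div (reg 5) (reg 2)) (.const 1)))))
            (.load 1 (.sub (.div (reg 5) (reg 2)) (.const 1))))
            (.load 5 (.sub (reg 5) (reg 2))))).eval s' = true ↔
          C.key pm k ≤ x ∧ dp (C.key pm) C.w C.B k (x - C.key pm k) + C.w k ≤
            dp (C.key pm) C.w C.B k x := by
        simp only [Test.eval, NatExpr.eval, hr, h2', hdiv, e1, e2, Nat.add_sub_cancel, hk, t1,
          hC'.w, Bool.and_eq_true, decide_eq_true_eq]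
        -- Both conjuncts are evaluated, but the entry read in the second one is the right one only
        -- if the subtraction of the key is not truncated.
        refine and_congr_right fun hle => ?_
        rw [t2 hle]
      refine (Ends.ite (k := 1) H (by simp [Test.len, NatExpr.len]; omega) hs' ?_ ?_).mono
        (by omega) fun _ _ => id
      · intro hb'
        rw [hev] at hb'
        have hv : dp (C.key pm) C.w C.B k (x - C.key pm k) + C.w k =
            dp (C.key pm) C.w C.B (k + 1) x := by rw [dp, if_pos hb']
        refine Ends.setNat (by simp [NatExpr.len]; omega) hs' ?_ ?_
        · simp only [NatExpr.eval, hr, h2', hdiv, e1, Nat.add_sub_cancel, hk, hC'.w, t2 hb'.1, hv]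
          exact hdp
        · simp only [NatExpr.eval, hr, h2', hdiv, e1, Nat.add_sub_cancel, hk, hC'.w, t2 hb'.1]
          exact fin _ hv
      · intro hb'
        rw [← Bool.not_eq_true, hev] at hb'
        have hv : dp (C.key pm) C.w C.B k x =
            dp (C.key pm) C.w C.B (k + 1) x := by rw [dp, if_neg hb']
        refine Ends.setNat (by simp [NatExpr.len]; omega) hs' ?_ ?_
        · simp only [NatExpr.eval, hr, h2', e1, t1, hv]
          exact hdp
        · simp only [NatExpr.eval, hr, h2', e1, t1]
          exact fin _ hv
  · rintro s' ⟨hF, hT⟩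
    refine ⟨hF, fun i hi x hx => hT i x hx ?_⟩
    have := Nat.mul_le_mul_right C.D hi
    rw [add_mul]
    omega

end Phases

end KnapExp

namespace KnapExp

section Phases

variable {K : Type} [Field K] [LinearOrder K] {sz h : K → ℕ} {S l : ℕ} {C : Data K} {s : State K}

theorem lastCmd_ends {c : ℕ → ℕ} (H : SizeBound sz h) (hl : 1000 ≤ l)
    (hS : ∀ m ≤ C.big, Nat.size m ≤ S)
    (hs : Bdd h S s) (hC : Holds C s) (h2 : s.nat 3 2 = C.D) (h3 : s.nat 3 3 = 0)
    (h5 : ∀ x < C.D, s.nat 5 (C.n * C.D + x) = dp c C.w C.B C.n x) :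
    Ends sz h S l (C.D * 4 + 2) lastCmd s fun s' => Frame [] [3, 5] s s' ∧
      s'.nat 3 3 < C.D ∧ dp c C.w C.B C.n (s'.nat 3 3) ≤ C.B ∧
      ∀ x < C.D, dp c C.w C.B C.n x ≤ C.B → x ≤ s'.nat 3 3 := by
  have hDS : ∀ m ≤ C.D, Nat.size m ≤ S := fun m hm => hS _ (hm.trans C.D_le_big)
  refine Ends.forLoop H (m := C.D) (k := 2) (fun i s' => Frame [] [3, 5] s s' ∧
      s'.nat 3 3 < C.D ∧ dp c C.w C.B C.n (s'.nat 3 3) ≤ C.B ∧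
      ∀ x < i, dp c C.w C.B C.n x ≤ C.B → x ≤ s'.nat 3 3)
    (by simp [NatExpr.len]; omega) hs (hDS _ le_rfl)
    ⟨(Frame.refl _ _ _).writeReg (by simp), by simp [h3, C.D_pos], ?_, by simp⟩ ?_ ?_ ?_
  -- The initial value `0` of the register is the key of the empty packing.
  · have := dp_sum_le c C.w C.B C.n ∅ (by simp)
    simp only [Finset.sum_empty] at this
    simp only [nat_writeNat, if_true, Function.update_apply]
    rw [if_neg (by decide), h3]
    omega
  · rintro i s' ⟨hF, -⟩
    simp [NatExpr.eval, hF.reg 2, h2]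
  · rintro i s' hi hs' ⟨hF, hlt, hB, hlast⟩ hr
    have hC' := hC.frame hF (by simp) (by simp) (by simp)
    have h2' : s'.nat 3 2 = C.D := by rw [hF.reg 2 (by simp), h2]
    have h5' := h5 i hi
    rw [← hF.nat 5 (by simp) (by simp)] at h5'
    have hev : (Test.natLe (.load 5 (.add (.mul nE (reg 2)) (reg 5))) capE).eval s' = true ↔
        dp c C.w C.B C.n i ≤ C.B := by
      simp [Test.eval, NatExpr.eval, hr, h2', hC'.n, hC'.B, h5']
    refine Ends.ite H (by simp [Test.len, NatExpr.len]; omega) hs' ?_ ?_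
    · intro hb
      rw [hev] at hb
      refine Ends.setNat (by simp [NatExpr.len]; omega) hs' (by simpa [NatExpr.eval] using hs'.1 _ _) ?_
      simp only [NatExpr.eval, hr]
      refine ⟨by simp [hr], (hF.writeReg (by simp)).writeReg (by simp), by simpa using hi,
        by simpa using hb, fun x hx _ => ?_⟩
      simp
      omega
    · intro hb
      rw [← Bool.not_eq_true, hev] at hb
      refine Ends.skip (by omega) hs' ⟨hr, hF.writeReg (by simp), by simpa using hlt,
        by simpa using hB, fun x hx hx' => ?_⟩
      rcases Nat.lt_succ_iff_lt_or_eq.1 hx with hx | rfl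
      · simpa using hlast x hx hx'
      · exact absurd hx' hb
  · exact fun _ => id

theorem sub_div_mul_eq_mod (a b : ℕ) : a - a / b * b = a % b := Nat.mod_eq_sub_div_mul.symm

theorem bestCmd_ends {c : ℕ → ℕ} {xl : ℕ} (H : SizeBound sz h) (hl : 1000 ≤ l)
    (hS : ∀ m ≤ C.big, Nat.size m ≤ S)
    (hs : Bdd h S s) (hC : Holds C s) (h2 : s.nat 3 2 = C.D) (h3 : s.nat 3 3 = xl)
    (hxl : xl < C.D) (hxlB : dp c C.w C.B C.n xl ≤ C.B)
    (h5 : ∀ x < C.D, s.nat 5 (C.n * C.D + x) = dp c C.w C.B C.n x) :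
    Ends sz h S l (C.D * 4 + 3) bestCmd s fun s' => Frame [] [4, 5] s s' ∧
      s'.nat 3 4 < C.D ∧ dp c C.w C.B C.n (s'.nat 3 4) ≤ C.B ∧
      xl / (C.n + 1) ≤ s'.nat 3 4 / (C.n + 1) + C.n ∧
      ∀ x < C.D, dp c C.w C.B C.n x ≤ C.B → xl / (C.n + 1) ≤ x / (C.n + 1) + C.n →
        s'.nat 3 4 % (C.n + 1) ≤ x % (C.n + 1) := by
  have hDS : ∀ m ≤ C.D, Nat.size m ≤ S := fun m hm => hS _ (hm.trans C.D_le_big)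
  refine (Ends.seq (k := 1) (k' := C.D * (2 + 2) + 2) (Ends.setNat (by simp [NatExpr.len]; omega)
    hs (by simpa [NatExpr.eval] using hs.1 _ _) ?_)).mono (by omega) fun _ _ => id
  simp only [NatExpr.eval, h3]
  intro hs1
  refine Ends.forLoop H (m := C.D) (k := 2) (fun i s' => Frame [] [4, 5] s s' ∧
      s'.nat 3 4 < C.D ∧ dp c C.w C.B C.n (s'.nat 3 4) ≤ C.B ∧
      xl / (C.n + 1) ≤ s'.nat 3 4 / (C.n + 1) + C.n ∧
      ∀ x < i, dp c C.w C.B C.n x ≤ C.B → xl / (C.n + 1) ≤ x / (C.n + 1) + C.n →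
        s'.nat 3 4 % (C.n + 1) ≤ x % (C.n + 1))
    (by simp [NatExpr.len]; omega) hs1 (hDS _ le_rfl)
    ⟨((Frame.refl _ _ _).writeReg (by simp)).writeReg (by simp), by simp [hxl], by simpa using hxlB,
      by simp, by simp⟩ ?_ ?_ ?_
  · rintro i s' ⟨hF, -⟩
    simp [NatExpr.eval, hF.reg 2, h2]
  · rintro i s' hi hs' ⟨hF, hlt, hB, hv, hmin⟩ hr
    have hC' := hC.frame hF (by simp) (by simp) (by simp)
    have h2' : s'.nat 3 2 = C.D := by rw [hF.reg 2 (by simp), h2]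
    have h3' : s'.nat 3 3 = xl := by rw [hF.reg 3 (by simp), h3]
    have h5' := h5 i hi
    rw [← hF.nat 5 (by simp) (by simp)] at h5'
    have hev : (Test.and (.natLe (.load 5 (.add (.mul nE (reg 2)) (reg 5))) capE)
          (.and (.natLe (.div (reg 3) nE₁) (.add (.div (reg 5) nE₁) nE))
            (.natLe (modE (reg 5) nE₁) (modE (reg 4) nE₁)))).eval s' = true ↔
        dp c C.w C.B C.n i ≤ C.B ∧ xl / (C.n + 1) ≤ i / (C.n + 1) + C.n ∧
          i % (C.n + 1) ≤ s'.nat 3 4 % (C.n + 1) := by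
      simp only [Test.eval, NatExpr.eval, hr, h2', h3', hC'.n, hC'.B, h5', Bool.and_eq_true,
        decide_eq_true_eq, sub_div_mul_eq_mod]
    refine Ends.ite H (by simp [Test.len, NatExpr.len]; omega) hs' ?_ ?_
    · intro hb
      rw [hev] at hb
      refine Ends.setNat (by simp [NatExpr.len]; omega) hs' (by simpa [NatExpr.eval] using hs'.1 _ _) ?_
      simp only [NatExpr.eval, hr]
      refine ⟨by simp [hr], (hF.writeReg (by simp)).writeReg (by simp), by simpa using hi,
        by simpa using hb.1, by simpa using hb.2.1, fun x hx h6 h7 => ?_⟩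
      simp
      rcases Nat.lt_succ_iff_lt_or_eq.1 hx with hx | rfl
      · exact hb.2.2.trans (hmin x hx h6 h7)
      · exact le_rfl
    · intro hb
      rw [← Bool.not_eq_true, hev] at hb
      refine Ends.skip (by omega) hs' ⟨hr, hF.writeReg (by simp), by simpa using hlt,
        by simpa using hB, by simpa using hv, fun x hx h6 h7 => ?_⟩
      rcases Nat.lt_succ_iff_lt_or_eq.1 hx with hx | rfl
      · simpa using hmin x hx h6 h7
      · simp only [not_and, not_le] at hb
        simpa using (hb h6 h7).le
  · exact fun _ => id

/-- Backtracking from the last item: item `i` is taken when row `i + 1` improves on row `i`. The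
invariant is that the remaining entry plus the weight taken so far is at most `B`. -/
theorem traceCmd_ends {c : ℕ → ℕ} {xb : ℕ} (H : SizeBound sz h) (hl : 1000 ≤ l)
    (hS : ∀ m ≤ C.big, Nat.size m ≤ S)
    (hs : Bdd h S s) (hC : Holds C s) (h2 : s.nat 3 2 = C.D) (h4 : s.nat 3 4 = xb)
    (hxb : xb < C.D) (hxbB : dp c C.w C.B C.n xb ≤ C.B)
    (hc : ∀ i < C.n, s.nat 4 i = c i)
    (h5 : ∀ i ≤ C.n, ∀ x < C.D, s.nat 5 (i * C.D + x) = dp c C.w C.B i x)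
    (h6 : ∀ i, s.nat 6 i = 0) :
    Ends sz h S l (C.n * 5 + 2) traceCmd s fun s' => Frame [6] [4, 5] s s' ∧
      ∃ A ⊆ Finset.range C.n, (∀ i, s'.nat 6 i ≠ 0 ↔ i ∈ A) ∧
        ∑ i ∈ A, c i = xb ∧ ∑ i ∈ A, C.w i ≤ C.B := by
  refine Ends.forLoop H (m := C.n) (k := 2 + 1) (fun a s' => Frame [6] [4, 5] s s' ∧
    ∃ A ⊆ Finset.Ico (C.n - a) C.n, (∀ i, s'.nat 6 i ≠ 0 ↔ i ∈ A) ∧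
        s'.nat 3 4 + ∑ i ∈ A, c i = xb ∧
        dp c C.w C.B (C.n - a) (s'.nat 3 4) + ∑ i ∈ A, C.w i ≤ C.B)
    (by simp [NatExpr.len]; omega) hs (hS _ (C.n_lt_D.le.trans C.D_le_big))
    ⟨(Frame.refl _ _ _).writeReg (by simp), ∅, by simp, by simp [h6], by simpa using h4, ?_⟩ ?_ ?_ ?_
  · simpa [h4] using hxbB
  · rintro i s' ⟨hF, -⟩
    exact (hC.frame hF (by simp) (by simp) (by simp)).n
  · rintro a s' ha hs' ⟨hF, A, hA, hmark, hx, hB⟩ hr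
    have hC' := hC.frame hF (by simp) (by simp) (by simp)
    have h2' : s'.nat 3 2 = C.D := by rw [hF.reg 2 (by simp), h2]
    obtain ⟨i, hi⟩ : ∃ i, C.n - a = i + 1 := ⟨C.n - a - 1, by omega⟩
    have hi' : C.n - (a + 1) = i := by omega
    rw [hi] at hA hB
    have hxD : s'.nat 3 4 < C.D := by omega
    have e0 := h5 i (by omega) _ hxD
    have e1 := h5 (i + 1) (by omega) _ hxD
    have ec := hc i (by omega)
    rw [← hF.nat 5 (by simp) (by simp)] at e0 e1
    rw [← hF.nat 4 (by simp) (by simp)] at ec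
    have hev : (Test.not (.natLe
        (.load 5 (.add (.mul (.sub nE (.add (reg 5) (.const 1))) (reg 2)) (reg 4)))
        (.load 5 (.add (.mul (.add (.sub nE (.add (reg 5) (.const 1))) (.const 1)) (reg 2))
          (reg 4))))).eval s' = true ↔
        dp c C.w C.B (i + 1) (s'.nat 3 4) < dp c C.w C.B i (s'.nat 3 4) := by
      simp [Test.eval, NatExpr.eval, hr, h2', hC'.n, hi', e0, e1]
    refine Ends.ite H (by simp [Test.len, NatExpr.len]; omega) hs' ?_ ?_
    · intro hb
      rw [hev] at hb
      obtain ⟨hle, heq⟩ := dp_succ_of_lt hb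
      have hiA : i ∉ A := fun h => by simpa using hA h
      refine Ends.seq (k := 1) (k' := 1) (Ends.setNat (by simp [NatExpr.len]; omega) hs'
        (by simp [NatExpr.eval]; exact hS 1 (by unfold Data.big; omega)) ?_)
      simp only [NatExpr.eval, hr, hC'.n, hi']
      intro hs1
      have e3 : s'.nat 3 5 = a := hr
      refine Ends.setNat (by simp [NatExpr.len]; omega) hs1 ?_ ?_
      · simp [NatExpr.eval, hr, hC'.n, hi', ec]
        exact hS _ (by have := C.D_le_big; omega)
      · simp [NatExpr.eval, hr, hC'.n, hi', ec]
        refine ⟨((hF.writeNat (by simp) (by simp)).writeReg (by simp)).writeReg (by simp),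
          insert i A, ?_, ?_, ?_, ?_⟩
        · refine Finset.insert_subset (Finset.mem_Ico.2 (by omega)) (hA.trans ?_)
          exact Finset.Ico_subset_Ico (by omega) le_rfl
        · intro k
          rw [Finset.mem_insert, ← hmark k, Function.update_apply]
          split_ifs with hk <;> simp [hk]
        · rw [Finset.sum_insert hiA]; omega
        · rw [Finset.sum_insert hiA]; omega
    · intro hb
      rw [← Bool.not_eq_true, hev, not_lt] at hb
      refine (Ends.skip (by omega) hs' ⟨hr, hF.writeReg (by simp), A, ?_, by simpa using hmark,
        by simpa using hx, ?_⟩).mono (by omega) fun _ _ => id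
      · rw [hi']
        exact hA.trans (Finset.Ico_subset_Ico (by omega) le_rfl)
      · rw [hi']
        simp
        omega
  · rintro s' ⟨hF, A, hA, hmark, hx, hB⟩
    rw [Nat.sub_self] at hB hA
    refine ⟨hF, A, by simpa using hA, hmark, ?_, by omega⟩
    -- In row `0`, every key other than zero has the sentinel `B + 1`.
    have : s'.nat 3 4 = 0 := by
      by_contra h0
      rw [dp, if_neg h0] at hB
      omega
    omega

theorem beforeT_eval (hC : Holds C s) {y i : ℕ} (hy : s.nat 3 5 = y) (hi : s.nat 3 6 = i) :
    beforeT.eval s = true ↔ Before (score C.w C.U (y / (C.n + 1))) (y % (C.n + 1)) i := by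
  simp only [Test.eval, NumExpr.eval, NatExpr.eval, hC.n, hC.U, hC.w, hy, hi,
    sub_div_mul_eq_mod, Bool.and_eq_false_iff, Bool.not_eq_false', Bool.and_eq_true,
    decide_eq_true_eq, Bool.not_eq_true', decide_eq_false_iff_not, Before, score]

theorem queried_eq (n : ℕ) (w : ℕ → ℕ) (L U : ℕ → K) (j r : ℕ) :
    queried n w L U j r = ∑ i ∈ Finset.range n,
      if ¬ U i ≤ L i ∧ Before (score w U j) r i then 1 else 0 := by
  rw [queried, nontriv, Finset.filter_filter, Finset.card_filter]

theorem remaining_eq (n B : ℕ) (w : ℕ → ℕ) (L U : ℕ → K) (j r : ℕ) :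
    remaining n B w L U j r = U j / w j * B + ∑ i ∈ Finset.range n,
      if ¬ U i ≤ L i ∧ ¬ Before (score w U j) r i then max (score w U j i) 0 else 0 := by
  rw [remaining, nontriv, Finset.filter_filter, Finset.sum_filter]

theorem queried_le (n : ℕ) (w : ℕ → ℕ) (L U : ℕ → K) (j r : ℕ) : queried n w L U j r ≤ n := by
  refine (Finset.card_le_card ((Finset.filter_subset _ _).trans (Finset.filter_subset _ _))).trans ?_
  simp

/-- By subadditivity, the size of the accumulated sum grows by at most `b + 1` per item. This is why
`S` must exceed `n * (b + 1)`. -/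
theorem evalCmd_ends {y b : ℕ} (H : SizeBound sz h) (hl : 1000 ≤ l)
    (hS : ∀ m ≤ C.big, Nat.size m ≤ S) (hb : ∀ j i, h (score C.w C.U j i) ≤ b)
    (hbS : C.n * (b + 1) + 1 ≤ S)
    (hs : Bdd h S s) (hC : Holds C s) (h5 : s.nat 3 5 = y) (h9 : s.nat 3 9 = 0)
    (h30 : s.num 3 0 = 0) :
    Ends sz h S l (C.n * 6 + 2) evalCmd s fun s' => Frame [] [6, 9] s s' ∧
      s'.nat 3 9 = queried C.n C.w C.L C.U (y / (C.n + 1)) (y % (C.n + 1)) ∧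
      C.U (y / (C.n + 1)) / C.w (y / (C.n + 1)) * C.B + s'.num 3 0 =
        remaining C.n C.B C.w C.L C.U (y / (C.n + 1)) (y % (C.n + 1)) := by
  have hnS : ∀ m ≤ C.n, Nat.size m ≤ S :=
    fun m hm => hS _ (hm.trans (C.n_lt_D.le.trans C.D_le_big))
  rw [queried_eq, remaining_eq]
  set j := y / (C.n + 1)
  set r := y % (C.n + 1)
  refine Ends.forLoop H (m := C.n) (k := 4) (fun k s' => Frame [] [6, 9] s s' ∧
      s'.nat 3 9 ≤ k ∧ h (s'.num 3 0) ≤ k * (b + 1) + 1 ∧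
      s'.nat 3 9 = ∑ i ∈ Finset.range k,
        (if ¬ C.U i ≤ C.L i ∧ Before (score C.w C.U j) r i then 1 else 0) ∧
      s'.num 3 0 = ∑ i ∈ Finset.range k,
        if ¬ C.U i ≤ C.L i ∧ ¬ Before (score C.w C.U j) r i then max (score C.w C.U j i) 0 else 0)
    (by simp [NatExpr.len]; omega) hs (hnS _ le_rfl)
    ⟨(Frame.refl _ _ _).writeReg (by simp), by simp [h9], ?_, by simp [h9], by simp [h30]⟩ ?_ ?_ ?_
  · simpa [h30] using H.natCast 0
  · rintro i s' ⟨hF, -⟩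
    exact (hC.frame hF (by simp) (by simp) (by simp)).n
  · rintro k s' hk hs' ⟨hF, hcnt, hacc, h9', h30'⟩ hr
    have hC' := hC.frame hF (by simp) (by simp) (by simp)
    have h5' : s'.nat 3 5 = y := by rw [hF.reg 5 (by simp), h5]
    have hbk := beforeT_eval hC' h5' hr
    have hsc : (scoreE (reg 6)).eval s' = score C.w C.U j k := by
      simp [NumExpr.eval, NatExpr.eval, hC'.U, hC'.w, hC'.n, h5', hr, score, j]
    have hmono : k * (b + 1) + 1 ≤ (k + 1) * (b + 1) + 1 := by nlinarith
    simp only [Finset.sum_range_succ]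
    refine (Ends.ite (k := 3) H (by simp [Test.len, NumExpr.len, NatExpr.len]; omega) hs' ?_ ?_)
    · intro ht
      simp [Test.eval, NumExpr.eval, NatExpr.eval, hr, hC'.U, hC'.L] at ht
      refine (Ends.skip (by omega) hs' ⟨hr, hF.writeReg (by simp), ?_, ?_, ?_, ?_⟩).mono
        (by omega) fun _ _ => id
      · simp; omega
      · exact hacc.trans hmono
      · simpa [ht] using h9'
      · simpa [ht] using h30'
    · intro ht
      simp [Test.eval, NumExpr.eval, NatExpr.eval, hr, hC'.U, hC'.L] at ht
      refine (Ends.ite (k := 2) H (by simp [Test.len, NumExpr.len, NatExpr.len]; omega) hs' ?_ ?_)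
      · intro hbf
        rw [hbk] at hbf
        refine (Ends.setNat (by simp [NatExpr.len]; omega) hs' ?_ ?_).mono
          (by omega) fun _ _ => id
        · simp only [NatExpr.eval]
          exact hnS _ (by omega)
        · simp only [NatExpr.eval]
          refine ⟨by simp [hr], (hF.writeReg (by simp)).writeReg (by simp), ?_, ?_, ?_, ?_⟩
          · simp; omega
          · exact hacc.trans hmono
          · rw [if_pos ⟨not_le.2 ht, hbf⟩, ← h9']; simp
          · rw [if_neg fun h => h.2 hbf, add_zero, ← h30']; simp
      · intro hbf
        rw [← Bool.not_eq_true, hbk] at hbf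
        have hp : ¬ C.U k ≤ C.L k ∧ ¬ Before (score C.w C.U j) r k := ⟨not_le.2 ht, hbf⟩
        have hn : ¬ (¬ C.U k ≤ C.L k ∧ Before (score C.w C.U j) r k) := fun h => hbf h.2
        refine (Ends.ite (k := 1) H (by simp [Test.len, NumExpr.len, NatExpr.len]; omega) hs' ?_ ?_)
        · intro h0
          simp only [Test.eval, hsc, decide_eq_true_eq] at h0
          simp only [NumExpr.eval, NatExpr.eval, Nat.cast_zero] at h0
          have hsz : h (s'.num 3 0 + score C.w C.U j k) ≤ (k + 1) * (b + 1) + 1 := by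
            have := H.add (s'.num 3 0) (score C.w C.U j k)
            have := hb j k
            nlinarith
          have hev : (NumExpr.add (.load 3 (.const 0)) (scoreE (reg 6))).eval s' =
              s'.num 3 0 + score C.w C.U j k := by
            rw [NumExpr.eval, hsc]; rfl
          refine Ends.setNum H (by simp [NumExpr.len, NatExpr.len]; omega) hs' ?_ ?_
          · rw [hev]
            refine hsz.trans (le_trans ?_ hbS)
            have := Nat.mul_le_mul_right (b + 1) (show k + 1 ≤ C.n from hk)
            omega
          · rw [hev]
            simp only [NatExpr.eval]
            refine ⟨by simp [hr], hF.writeNum.writeReg (by simp), ?_, ?_, ?_, ?_⟩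
            · simp; omega
            · simpa using hsz
            · rw [if_neg hn, add_zero, ← h9']; simp
            · rw [if_pos hp, max_eq_left h0, ← h30']; simp
        · intro h0
          simp only [Test.eval, hsc, decide_eq_false_iff_not] at h0
          simp only [NumExpr.eval, NatExpr.eval, Nat.cast_zero] at h0
          refine (Ends.skip (by omega) hs' ⟨hr, hF.writeReg (by simp), ?_, ?_, ?_, ?_⟩)
          · simp; omega
          · exact hacc.trans hmono
          · rw [if_neg hn, add_zero, ← h9']; simp
          · rw [if_pos hp, max_eq_right (not_le.1 h0).le, add_zero, ← h30']; simp
  · rintro s' ⟨hF, -, -, h9', h30'⟩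
    exact ⟨hF, h9', by rw [h30']⟩

/-- The pair `(j, r)` is coded as `j * (n + 1) + r`. The search starts at `(n, n)`, which meets the
budget by `hpos`. Its count is not computed in advance: the minimum starts at the upper bound `n`,
so the invariant only requires that the stored candidate have at most that count. -/
theorem searchCmd_ends {pm xl b : ℕ} {bud : K} (H : SizeBound sz h) (hl : 1000 ≤ l)
    (hS : ∀ m ≤ C.big, Nat.size m ≤ S) (hb : ∀ j i, h (score C.w C.U j i) ≤ b)
    (hbS : C.n * (b + 1) + 1 ≤ S) (hS1 : 1 ≤ S)
    (hs : Bdd h S s) (hC : Holds C s) (h1 : s.nat 3 1 = pm) (h3 : s.nat 3 3 = xl)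
    (hbud : bud = C.p pm * (xl / (C.n + 1) : ℕ) / (C.n * C.N : ℕ))
    (hpos : remaining C.n C.B C.w C.L C.U C.n C.n ≤ bud) :
    Ends sz h S l ((C.n + 1) * (C.n + 1) * (C.n * 6 + 9) + 4) searchCmd s fun s' =>
      Frame [] [5, 6, 7, 8, 9] s s' ∧ ∃ j r, s'.nat 3 8 / (C.n + 1) = j ∧
        s'.nat 3 8 % (C.n + 1) = r ∧ j ≤ C.n ∧ remaining C.n C.B C.w C.L C.U j r ≤ bud ∧
        ∀ j' ≤ C.n, ∀ r' ≤ C.n, remaining C.n C.B C.w C.L C.U j' r' ≤ bud →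
          queried C.n C.w C.L C.U j r ≤ queried C.n C.w C.L C.U j' r' := by
  have hnS : ∀ m ≤ C.n, Nat.size m ≤ S :=
    fun m hm => hS _ (hm.trans (C.n_lt_D.le.trans C.D_le_big))
  have hnD : C.n + 1 ≤ C.D := C.n_lt_D
  have hsq : (C.n + 1) * (C.n + 1) ≤ C.big := by
    have := Nat.mul_le_mul_left (C.n + 1) hnD
    unfold Data.big
    omega
  have hlast : C.n * (C.n + 1) + C.n < (C.n + 1) * (C.n + 1) := by rw [add_mul C.n 1]; omega
  have hdiv : ∀ j r, r ≤ C.n → (j * (C.n + 1) + r) / (C.n + 1) = j := by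
    intro j r hr
    rw [add_comm, Nat.add_mul_div_right _ _ (by omega), Nat.div_eq_of_lt (by omega), zero_add]
  have hmod : ∀ j r, r ≤ C.n → (j * (C.n + 1) + r) % (C.n + 1) = r := by
    intro j r hr
    rw [add_comm, Nat.add_mul_mod_self_right, Nat.mod_eq_of_lt (by omega)]
  let rem : ℕ → K := fun y => remaining C.n C.B C.w C.L C.U (y / (C.n + 1)) (y % (C.n + 1))
  let qry : ℕ → ℕ := fun y => queried C.n C.w C.L C.U (y / (C.n + 1)) (y % (C.n + 1))
  refine (Ends.seq (k := 1) (k' := 1 + ((C.n + 1) * (C.n + 1) * (1 + (1 + (C.n * 6 + 2 + (1 + 1 + 1)))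
    + 2) + 2)) (Ends.setNat (by simp [NatExpr.len]; omega) hs ?_ ?_)).mono
      (by ring_nf; omega) fun _ _ => id
  · simp only [NatExpr.eval, hC.n]
    exact hnS _ le_rfl
  simp only [NatExpr.eval, hC.n]
  intro hs1
  have hF1 : Frame [] [5, 6, 7, 8, 9] s (s.writeNat 3 7 C.n) := (Frame.refl _ _ _).writeReg (by simp)
  have hC1 := hC.frame hF1 (by simp) (by simp) (by simp)
  have hy0 : (NatExpr.add (.mul nE nE₁) nE).eval (s.writeNat 3 7 C.n) =
      C.n * (C.n + 1) + C.n := by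
    simp only [NatExpr.eval, hC1.n]
  refine Ends.seq (Ends.setNat (by simp [NatExpr.len]; omega) hs1 ?_ ?_)
  · rw [hy0]
    exact hS _ (hlast.le.trans hsq)
  rw [hy0]
  simp only [NatExpr.eval]
  intro hs2
  refine Ends.forLoop H (m := (C.n + 1) * (C.n + 1)) (fun i s' => Frame [] [5, 6, 7, 8, 9] s s' ∧
      s'.nat 3 8 < (C.n + 1) * (C.n + 1) ∧ rem (s'.nat 3 8) ≤ bud ∧
      qry (s'.nat 3 8) ≤ s'.nat 3 7 ∧
      ∀ y < i, rem y ≤ bud → s'.nat 3 7 ≤ qry y)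
    (by simp [NatExpr.len]; omega) hs2 (hS _ hsq)
    ⟨(hF1.writeReg (by simp)).writeReg (by simp), by simpa using hlast, ?_, ?_, by simp⟩ ?_ ?_ ?_
  · simpa [rem, hdiv C.n C.n le_rfl, hmod C.n C.n le_rfl] using hpos
  · simpa [qry] using queried_le _ _ _ _ _ _
  · rintro i s' ⟨hF, -⟩
    have hC' := hC.frame hF (by simp) (by simp) (by simp)
    simp only [NatExpr.eval, hC'.n]
  · rintro y s' hy hs' ⟨hF, hlt, hrem, hq, hmin⟩ hr
    refine Ends.seq (Ends.setNat (by simp [NatExpr.len]; omega) hs' (by simp [NatExpr.eval]) ?_)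
    simp only [NatExpr.eval]
    intro hs3
    have h00 : h 0 ≤ 1 := by simpa using H.natCast 0
    refine Ends.seq (Ends.setNum H (by simp [NumExpr.len, NatExpr.len]; omega) hs3
      (by simpa [NumExpr.eval, NatExpr.eval] using h00.trans hS1) ?_)
    simp only [NumExpr.eval, NatExpr.eval, Nat.cast_zero]
    intro hs4
    have hF4 : Frame [] [5, 6, 7, 8, 9] s ((s'.writeNat 3 9 0).writeNum 3 0 0) :=
      (hF.writeReg (by simp)).writeNum
    refine Ends.seq ((evalCmd_ends H hl hS hb hbS hs4 (hC.frame hF4 (by simp) (by simp) (by simp))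
      (y := y) (by simpa using hr) (by simp) (by simp)).mono le_rfl ?_)
    rintro s'' - ⟨hF5, h9, h30⟩ hs5
    have hF' : Frame [] [5, 6, 7, 8, 9] s s'' := hF4.trans (hF5.mono (by simp) (by simp))
    have hC' := hC.frame hF' (by simp) (by simp) (by simp)
    have hr5 : s''.nat 3 5 = y := by rw [hF5.reg 5 (by simp)]; simpa using hr
    have e7 : s''.nat 3 7 = s'.nat 3 7 := by rw [hF5.reg 7 (by simp)]; simp
    have e8 : s''.nat 3 8 = s'.nat 3 8 := by rw [hF5.reg 8 (by simp)]; simp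
    have e1 : s''.nat 3 1 = pm := by rw [hF'.reg 1 (by simp), h1]
    have e3 : s''.nat 3 3 = xl := by rw [hF'.reg 3 (by simp), h3]
    have hev : (Test.and (.numLe
              (.add (.mul (.div (.load 2 priceE) (.ofNat (.load 1 priceE))) (.ofNat capE))
                (.load 3 (.const 0)))
              (.div (.mul (.load 0 (reg 1)) (.ofNat (.div (reg 3) nE₁))) (.ofNat (.mul nE (reg 0)))))
              (.natLe (reg 9) (reg 7))).eval s'' = true ↔ rem y ≤ bud ∧ qry y ≤ s'.nat 3 7 := by
      simp only [Test.eval, NumExpr.eval, NatExpr.eval, hr5, hC'.n, hC'.U, hC'.w, hC'.B, hC'.p,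
        hC'.N, h30, h9, e7, e1, e3, hbud, Bool.and_eq_true, decide_eq_true_eq, rem, qry]
    refine Ends.ite H (by simp [Test.len, NumExpr.len, NatExpr.len]; omega) hs5 ?_ ?_
    · intro hb'
      rw [hev] at hb'
      refine Ends.seq (Ends.setNat (by simp [NatExpr.len]; omega) hs5
        (by simpa [NatExpr.eval] using hs5.1 _ _) ?_)
      simp only [NatExpr.eval, h9]
      intro hs6
      refine Ends.setNat (by simp [NatExpr.len]; omega) hs6
        (by simpa [NatExpr.eval] using hs5.1 _ _) ?_
      have e5' : ∀ v, (s''.writeNat 3 7 v).nat 3 5 = y := fun v => by simp [hr5]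
      simp only [NatExpr.eval, e5']
      refine ⟨by simp [hr5], ((hF'.writeReg (by simp)).writeReg (by simp)).writeReg (by simp),
        by simpa using hy, by simpa using hb'.1, by simp [qry], fun y' hy' hy'' => ?_⟩
      simp
      rcases Nat.lt_succ_iff_lt_or_eq.1 hy' with hy' | rfl
      · exact hb'.2.trans (hmin y' hy' hy'')
      · exact le_rfl
    · intro hb'
      rw [← Bool.not_eq_true, hev] at hb'
      refine (Ends.skip (by omega) hs5 ⟨hr5, hF'.writeReg (by simp), by simpa [e8] using hlt,
        by simpa [e8] using hrem, by simpa [e7, e8] using hq, fun y' hy' hy'' => ?_⟩).mono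
          (by omega) fun _ _ => id
      simp [e7]
      rcases Nat.lt_succ_iff_lt_or_eq.1 hy' with hy' | rfl
      · exact hmin y' hy' hy''
      · exact (not_le.1 fun h => hb' ⟨hy'', h⟩).le
  · rintro s' ⟨hF, hlt, hrem, hq, hmin⟩
    refine ⟨hF, _, _, rfl, rfl, ?_, hrem, fun j hj r hr hjr => hq.trans ?_⟩
    · have := (Nat.div_lt_iff_lt_mul (by omega)).2 hlt
      omega
    · have h1 := Nat.mul_le_mul_right (C.n + 1) hj
      have := hmin (j * (C.n + 1) + r) (by omega)
      simp only [rem, qry, hdiv j r hr, hmod j r hr] at this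
      exact this hjr

theorem outCmd_ends {y : ℕ} (H : SizeBound sz h) (hl : 1000 ≤ l)
    (hS : ∀ m ≤ C.big, Nat.size m ≤ S)
    (hs : Bdd h S s) (hC : Holds C s) (h8 : s.nat 3 8 = y) (h2 : ∀ i, s.nat 2 i = 0) :
    Ends sz h S l (C.n * 4 + 3) outCmd s fun s' => ∀ i < C.n, s'.nat 2 i ≠ 0 ↔
      i ∈ nontriv C.n C.L C.U ∧ (s.nat 6 i ≠ 0 ∨
        Before (score C.w C.U (y / (C.n + 1))) (y % (C.n + 1)) i) := by
  refine (Ends.seq (k := 1) (k' := C.n * (2 + 2) + 2) (Ends.setNat (by simp [NatExpr.len]; omega)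
    hs (by simpa [NatExpr.eval] using hs.1 _ _) ?_)).mono (by omega) fun _ _ => id
  simp only [NatExpr.eval, h8]
  intro hs1
  refine Ends.forLoop H (m := C.n) (k := 2) (fun k s' => Frame [2] [5, 6] s s' ∧
    s'.nat 3 5 = y ∧ ∀ i, s'.nat 2 i ≠ 0 ↔ i < k ∧ ¬ C.U i ≤ C.L i ∧ (s.nat 6 i ≠ 0 ∨
        Before (score C.w C.U (y / (C.n + 1))) (y % (C.n + 1)) i))
    (by simp [NatExpr.len]; omega) hs1 (hS _ (C.n_lt_D.le.trans C.D_le_big))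
    ⟨((Frame.refl _ _ _).writeReg (by simp)).writeReg (by simp), by simp, by simp [h2]⟩ ?_ ?_ ?_
  · rintro i s' ⟨hF, -⟩
    exact (hC.frame hF (by simp) (by simp) (by simp)).n
  · rintro k s' hk hs' ⟨hF, h5, hmark⟩ hr
    have hC' := hC.frame hF (by simp) (by simp) (by simp)
    have hbk := beforeT_eval hC' h5 hr
    have h6' : s'.nat 6 = s.nat 6 := hF.nat 6 (by simp) (by simp)
    have hev : (Test.and (.not (.numLe (.load 2 (reg 6)) (.load 1 (reg 6))))
          (.not (.and (.natLe (.load 6 (reg 6)) (.const 0)) (.not beforeT)))).eval s' = true ↔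
        ¬ C.U k ≤ C.L k ∧ (s.nat 6 k ≠ 0 ∨
        Before (score C.w C.U (y / (C.n + 1))) (y % (C.n + 1)) k) := by
      generalize beforeT = t at hbk ⊢
      rw [← hbk]
      cases ht : t.eval s' <;>
        simp [Test.eval, NumExpr.eval, NatExpr.eval, hr, hC'.U, hC'.L, h6', ht]
    refine Ends.ite H (by simp [Test.len, NumExpr.len, NatExpr.len]; omega) hs' ?_ ?_
    · intro hb
      rw [hev] at hb
      refine Ends.setNat (by simp [NatExpr.len]; omega) hs'
        (by simp [NatExpr.eval]; exact hS 1 (by unfold Data.big; omega)) ?_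
      simp only [NatExpr.eval, hr]
      refine ⟨by simp [hr], (hF.writeNat (by simp) (by simp)).writeReg (by simp), by simp [h5], ?_⟩
      intro i
      by_cases hik : i = k
      · subst hik
        simpa using hb
      · have : i < k + 1 ↔ i < k := by omega
        simpa [hik, this] using hmark i
    · intro hb
      rw [← Bool.not_eq_true, hev] at hb
      refine Ends.skip (by omega) hs' ⟨hr, hF.writeReg (by simp), by simpa using h5, ?_⟩
      intro i
      by_cases hik : i = k
      · subst hik
        have := hmark i
        simp only [lt_irrefl, false_and, iff_false] at this
        have e : (s'.writeNat 3 6 (i + 1)).nat 2 i = s'.nat 2 i := by simp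
        rw [e]
        tauto
      · have : i < k + 1 ↔ i < k := by omega
        simpa [this] using hmark i
  · rintro s' ⟨hF, -, hmark⟩ i hi
    rw [hmark i, nontriv, Finset.mem_filter, Finset.mem_range]
    tauto

end Phases

end KnapExp

namespace KnapExp

/-! ### Composition of the phases and the running time -/

section Algorithm

variable {K : Type} [Field K] [LinearOrder K] {sz h : K → ℕ} {S l : ℕ}

/-- A function on the items, extended by zero. -/
def extend {α : Type} [Zero α] {n : ℕ} (f : Fin n → α) (j : ℕ) : α :=
  if h : j < n then f ⟨j, h⟩ else 0

theorem extend_val {α : Type} [Zero α] {n : ℕ} (f : Fin n → α) (i : Fin n) :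
    extend f i = f i := by simp [extend]

theorem extend_of_le {α : Type} [Zero α] {n : ℕ} (f : Fin n → α) {j : ℕ} (hj : n ≤ j) :
    extend f j = 0 := by simp [extend, hj]

/-- An instance as input data of the algorithm. -/
def Inst.data {n : ℕ} (I : Inst K n) (N : ℕ) : Data K where
  n := n
  B := I.B
  N := N
  w := extend I.w
  p := extend I.p
  L := extend I.L
  U := extend I.U

/-- The number of steps of the algorithm. -/
def steps (N n : ℕ) : ℕ :=
  1 + (n * 4 + 2) + 1 + (n * (2 * n * N * 4 + 7) + 2) +
    ((n + 1) * ((n * (2 * n * N) + 1) * (n + 1)) * 5 + 2) +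
    ((n * (2 * n * N) + 1) * (n + 1) * 4 + 2) + ((n * (2 * n * N) + 1) * (n + 1) * 4 + 3) +
    (n * 5 + 2) + ((n + 1) * (n + 1) * (n * 6 + 9) + 4) + (n * 4 + 3)

/-- What the algorithm computes: `A` is the packing found by the dynamic program and `(j, r)` is
the best candidate. -/
structure Computes (C : Data K) (s : State K) (pm xl xb j r : ℕ) (A : Finset ℕ) : Prop where
  le_max : ∀ i < C.n, C.p i ≤ C.p pm
  max_lt : 0 < C.n → pm < C.n
  last_le : dp (C.key pm) C.w C.B C.n xl ≤ C.B
  last : ∀ x < C.D, dp (C.key pm) C.w C.B C.n x ≤ C.B → x ≤ xl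
  best_le : xl / (C.n + 1) ≤ xb / (C.n + 1) + C.n
  best : ∀ x < C.D, dp (C.key pm) C.w C.B C.n x ≤ C.B →
    xl / (C.n + 1) ≤ x / (C.n + 1) + C.n → xb % (C.n + 1) ≤ x % (C.n + 1)
  subset : A ⊆ Finset.range C.n
  sum_key : ∑ i ∈ A, C.key pm i = xb
  sum_weight : ∑ i ∈ A, C.w i ≤ C.B
  price_le : j ≤ C.n
  remaining_le : remaining C.n C.B C.w C.L C.U j r ≤
    C.p pm * (xl / (C.n + 1) : ℕ) / (C.n * C.N : ℕ)
  queried_le : ∀ j' ≤ C.n, ∀ r' ≤ C.n, remaining C.n C.B C.w C.L C.U j' r' ≤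
    C.p pm * (xl / (C.n + 1) : ℕ) / (C.n * C.N : ℕ) →
      queried C.n C.w C.L C.U j r ≤ queried C.n C.w C.L C.U j' r'
  mark_iff : ∀ i < C.n, s.nat 2 i ≠ 0 ↔ i ∈ nontriv C.n C.L C.U ∧
    (i ∈ A ∨ Before (score C.w C.U j) r i)

/-- At price zero and threshold zero, all positive upper limits are queried and nothing is left. -/
theorem remaining_last {n B : ℕ} {w : ℕ → ℕ} {L U : ℕ → K} (hU : U n = 0) :
    remaining n B w L U n n = 0 := by
  rw [remaining, hU, zero_div, zero_mul, zero_add]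
  refine Finset.sum_eq_zero fun i hi => max_eq_right ?_
  have := le_of_not_before (Finset.mem_filter.1 hi).2
  simpa [score, hU] using this

theorem algorithm_ends [IsStrictOrderedRing K] {n N b : ℕ} (I : Inst K n) (H : SizeBound sz h)
    (hl : 1000 + N ≤ l) (hS : ∀ m ≤ (I.data N).big, Nat.size m ≤ S)
    (hb : ∀ j i, h (score (I.data N).w (I.data N).U j i) ≤ b)
    (hbS : n * (b + 1) + 1 ≤ S) (hs : Bdd h S (initState I)) :
    Ends sz h S l (steps N n) (algorithm N) (initState I) fun s' =>
      ∃ pm xl xb j r A, Computes (I.data N) s' pm xl xb j r A := by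
  have hl' : 1000 ≤ l := by omega
  set C := I.data N with hCdef
  have hU : C.U n = 0 := extend_of_le _ le_rfl
  have hp : ∀ i, 0 ≤ C.p i := by
    intro i
    change 0 ≤ extend I.p i
    unfold extend
    split_ifs
    · exact I.p_nonneg _
    · exact le_rfl
  set s₀ := initState I with hs₀
  let s₁ := s₀.writeNat 3 0 N
  have h3 : ∀ r ≠ 0, s₁.nat 3 r = 0 := by
    intro r hr
    simp [s₁, hr, hs₀, initState]
  have hC : Holds C s₁ := by
    constructor <;> simp [s₁, hs₀, initState, hCdef, Inst.data] <;> rfl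
  have h2 : ∀ i, s₁.nat 2 i = 0 := by intro i; simp [s₁, hs₀, initState]
  have h6 : ∀ i, s₁.nat 6 i = 0 := by intro i; simp [s₁, hs₀, initState]
  refine (Ends.seq (k := 1) (k' := (C.n * (2 + 2) + 2) + (1 + ((C.n * (C.M * 4 + 7) + 2) +
    (((C.n + 1) * C.D * 5 + 2) + ((C.D * 4 + 2) + ((C.D * 4 + 3) + ((C.n * 5 + 2) +
    (((C.n + 1) * (C.n + 1) * (C.n * 6 + 9) + 4) + (C.n * 4 + 3)))))))))
    (Ends.setNat (by simp [NatExpr.len]; omega) hs ?_ ?_)).mono ?_ fun _ _ => id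
  · simp only [NatExpr.eval]
    exact hS N (by change N ≤ (C.n + 1) * C.D + C.B + 1 + N; omega)
  · simp only [NatExpr.eval]
    intro hb1
    refine Ends.seq ((maxCmd_ends H hl' hS hb1 hC (h3 1 (by simp))).mono le_rfl ?_)
    rintro s₂ - ⟨hF2, hmax, hmaxn⟩ hb2
    have hC2 := hC.frame hF2 (by simp) (by simp) (by simp)
    have hD : (NatExpr.mul (.add (.mul nE scaleE) (.const 1)) nE₁).eval s₂ = C.D := by
      simp only [NatExpr.eval, hC2.n, hC2.N]
      rfl
    refine Ends.seq (Ends.setNat (by simp [NatExpr.len]; omega) hb2 ?_ ?_)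
    · rw [hD]
      exact hS _ C.D_le_big
    rw [hD]
    simp only [NatExpr.eval]
    intro hb3
    have hF3 : Frame [] [1, 2, 5] s₁ (s₂.writeNat 3 2 C.D) :=
      (hF2.mono (by simp) (by simp)).writeReg (by simp)
    have hC3 := hC.frame hF3 (by simp) (by simp) (by simp)
    obtain ⟨pm, hpm⟩ : ∃ pm, s₂.nat 3 1 = pm := ⟨_, rfl⟩
    rw [hpm] at hmax hmaxn
    have e31 : (s₂.writeNat 3 2 C.D).nat 3 1 = pm := by simp [hpm]
    have e32 : (s₂.writeNat 3 2 C.D).nat 3 2 = C.D := by simp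
    refine Ends.seq ((keyCmd_ends H hl' hS hb3 hC3 e31).mono le_rfl ?_)
    generalize s₂.writeNat 3 2 C.D = s₃ at *
    rintro s₄ - ⟨hF4, hkey⟩ hb4
    have hC4 := hC3.frame hF4 (by simp) (by simp) (by simp)
    have e42 : s₄.nat 3 2 = C.D := by rw [hF4.reg 2 (by simp), e32]
    refine Ends.seq ((tableCmd_ends H hl' hS hb4 hC4 e42 hkey).mono le_rfl ?_)
    rintro s₅ - ⟨hF5, htab⟩ hb5
    have hC5 := hC4.frame hF5 (by simp) (by simp) (by simp)
    have e52 : s₅.nat 3 2 = C.D := by rw [hF5.reg 2 (by simp), e42]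
    have e53 : s₅.nat 3 3 = 0 := by
      rw [hF5.reg 3 (by simp), hF4.reg 3 (by simp), hF3.reg 3 (by simp), h3 3 (by simp)]
    refine Ends.seq ((lastCmd_ends H hl' hS hb5 hC5 e52 e53 (htab _ le_rfl)).mono le_rfl ?_)
    rintro s₆ - ⟨hF6, hxlD, hxlB, hlast⟩ hb6
    have hC6 := hC5.frame hF6 (by simp) (by simp) (by simp)
    have e62 : s₆.nat 3 2 = C.D := by rw [hF6.reg 2 (by simp), e52]
    have htab6 := htab
    rw [← hF6.nat 5 (by simp) (by simp)] at htab6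
    refine Ends.seq ((bestCmd_ends H hl' hS hb6 hC6 e62 rfl hxlD hxlB (htab6 _ le_rfl)).mono
      le_rfl ?_)
    rintro s₇ - ⟨hF7, hxbD, hxbB, hxb, hbest⟩ hb7
    have hC7 := hC6.frame hF7 (by simp) (by simp) (by simp)
    have e72 : s₇.nat 3 2 = C.D := by rw [hF7.reg 2 (by simp), e62]
    have htab7 := htab6
    rw [← hF7.nat 5 (by simp) (by simp)] at htab7
    have hkey7 := hkey
    rw [← hF5.nat 4 (by simp) (by simp), ← hF6.nat 4 (by simp) (by simp),
      ← hF7.nat 4 (by simp) (by simp)] at hkey7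
    have e76 : ∀ i, s₇.nat 6 i = 0 := by
      rw [hF7.nat 6 (by simp) (by simp), hF6.nat 6 (by simp) (by simp),
        hF5.nat 6 (by simp) (by simp), hF4.nat 6 (by simp) (by simp),
        hF3.nat 6 (by simp) (by simp)]
      exact h6
    refine Ends.seq ((traceCmd_ends H hl' hS hb7 hC7 e72 rfl hxbD hxbB hkey7 htab7 e76).mono
      le_rfl ?_)
    rintro s₈ - ⟨hF8, A, hA, hmark, hAc, hAw⟩ hb8
    have hC8 := hC7.frame hF8 (by simp) (by simp) (by simp)
    have e81 : s₈.nat 3 1 = pm := by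
      rw [hF8.reg 1 (by simp), hF7.reg 1 (by simp), hF6.reg 1 (by simp), hF5.reg 1 (by simp),
        hF4.reg 1 (by simp), e31]
    have e83 : s₈.nat 3 3 = s₆.nat 3 3 := by rw [hF8.reg 3 (by simp), hF7.reg 3 (by simp)]
    refine Ends.seq ((searchCmd_ends H hl' hS hb hbS (by omega) hb8 hC8 e81 e83 rfl ?_).mono
      le_rfl ?_)
    · change remaining n _ _ _ _ n n ≤ _
      rw [remaining_last hU]
      exact div_nonneg (mul_nonneg (hp _) (Nat.cast_nonneg _)) (Nat.cast_nonneg _)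
    rintro s₉ - ⟨hF9, j, r, hj, hr, hjn, hrem, hq⟩ hb9
    have hC9 := hC8.frame hF9 (by simp) (by simp) (by simp)
    have e92 : ∀ i, s₉.nat 2 i = 0 := by
      rw [hF9.nat 2 (by simp) (by simp), hF8.nat 2 (by simp) (by simp),
        hF7.nat 2 (by simp) (by simp), hF6.nat 2 (by simp) (by simp),
        hF5.nat 2 (by simp) (by simp), hF4.nat 2 (by simp) (by simp),
        hF3.nat 2 (by simp) (by simp)]
      exact h2
    refine (outCmd_ends H hl' hS hb9 hC9 rfl e92).mono le_rfl ?_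
    intro s' _ hout
    refine ⟨pm, _, _, j, r, A, hmax, hmaxn, hxlB, hlast, hxb, hbest, hA, hAc, hAw, hjn, hrem, hq,
      fun i hi => ?_⟩
    rw [hout i hi, hj, hr, hF9.nat 6 (by simp) (by simp), hmark]
  · unfold steps
    change _ ≤ 1 + (C.n * 4 + 2) + 1 + (C.n * (C.M * 4 + 7) + 2) + ((C.n + 1) * C.D * 5 + 2) +
      (C.D * 4 + 2) + (C.D * 4 + 3) + (C.n * 5 + 2) +
      ((C.n + 1) * (C.n + 1) * (C.n * 6 + 9) + 4) + (C.n * 4 + 3)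
    omega

/-- The bound for the sizes of all cells, in terms of the encoding length of the instance. -/
def cellSize (N m : ℕ) : ℕ :=
  (m + 1) * ((m * (2 * m * N) + 1) * (m + 1)) + N + m + 2 + (m * (4 * m + 8) + 1)

/-- The running time, in terms of the encoding length of the instance. -/
def runningTime (N m : ℕ) : ℕ := steps N m * stepCost (1000 + N) (cellSize N m)

/-- It remains to see that one bound `S`, polynomial in the encoding length, covers the input and
everything stored. -/
theorem algorithm_runs [IsStrictOrderedRing K] {n : ℕ} (N : ℕ) (I : Inst K n)
    (H : SizeBound sz h) :
    ∃ t s, Exec sz (algorithm N) (initState I) t s ∧ t ≤ runningTime N (I.inputSize sz) ∧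
      ∃ pm xl xb j r A, Computes (I.data N) s pm xl xb j r A := by
  set m := I.inputSize sz with hm
  have hn : n ≤ m := by rw [hm, Inst.inputSize]; omega
  have hBm : Nat.size I.B ≤ m := by rw [hm, Inst.inputSize]; omega
  have hitem : ∀ i, Nat.size (I.w i) + sz (I.p i) + sz (I.L i) + sz (I.U i) ≤ m := by
    intro i
    have := Finset.single_le_sum
      (f := fun i => Nat.size (I.w i) + sz (I.p i) + sz (I.L i) + sz (I.U i))
      (fun _ _ => Nat.zero_le _) (Finset.mem_univ i)
    rw [hm, Inst.inputSize]
    exact this.trans (by omega)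
  have h00 : h 0 ≤ 1 := by simpa using H.natCast 0
  have hw : ∀ j, Nat.size (extend I.w j) ≤ m := by
    intro j
    unfold extend
    split_ifs with hj
    · have := hitem ⟨j, hj⟩; omega
    · simp
  have hK : ∀ f : Fin n → K, (∀ i, sz (f i) ≤ m) → ∀ j, h (extend f j) ≤ m + 1 := by
    intro f hf j
    unfold extend
    split_ifs with hj
    · exact (H.le_sz _).trans ((hf _).trans (by omega))
    · omega
  have hU := hK I.U fun i => by have := hitem i; omega
  have hS : ∀ k ≤ (I.data N).big, Nat.size k ≤ cellSize N m := by
    intro k hk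
    -- The capacity may be exponential in the input length, so it is split off and counted by its
    -- binary length; the rest is counted by its value.
    have hbig : (I.data N).big =
        ((n + 1) * ((n * (2 * n * N) + 1) * (n + 1)) + 1 + N) + I.B := by
      change (n + 1) * ((n * (2 * n * N) + 1) * (n + 1)) + I.B + 1 + N = _
      omega
    have h1 := Nat.size_le_size hk
    rw [hbig] at h1
    have h2 := size_add_le ((n + 1) * ((n * (2 * n * N) + 1) * (n + 1)) + 1 + N) I.B
    have h3 := size_le_self ((n + 1) * ((n * (2 * n * N) + 1) * (n + 1)) + 1 + N)
    have h4 : (n + 1) * ((n * (2 * n * N) + 1) * (n + 1)) ≤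
        (m + 1) * ((m * (2 * m * N) + 1) * (m + 1)) := by gcongr
    unfold cellSize
    omega
  have hmS : m + 1 ≤ cellSize N m := by unfold cellSize; omega
  -- Four input values of size at most `m + 1` each, joined by three operations.
  have hsc : ∀ j i, h (score (I.data N).w (I.data N).U j i) ≤ 4 * m + 7 := by
    intro j i
    change h (extend I.U i - extend I.U j / ((extend I.w j : ℕ) : K) * ((extend I.w i : ℕ) : K)) ≤ _
    have h1 := H.sub (extend I.U i) (extend I.U j / ((extend I.w j : ℕ) : K) * ((extend I.w i : ℕ) : K))
    have h2 := H.mul (extend I.U j / ((extend I.w j : ℕ) : K)) ((extend I.w i : ℕ) : K)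
    have h3 := H.div (extend I.U j) ((extend I.w j : ℕ) : K)
    have h4 := H.natCast (extend I.w j)
    have h5 := H.natCast (extend I.w i)
    have := hU i
    have := hU j
    have := hw i
    have := hw j
    omega
  have hnS : n * (4 * m + 7 + 1) + 1 ≤ cellSize N m := by
    have : n * (4 * m + 7 + 1) ≤ m * (4 * m + 8) := by gcongr
    unfold cellSize
    omega
  have hbd : Bdd h (cellSize N m) (initState I) := by
    constructor
    · intro a j
      refine le_trans ?_ hmS
      simp only [initState]
      split_ifs with h1 h2 h3 h4 h5
      · exact (size_le_self n).trans (by omega)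
      · omega
      · simp
      · have := hitem ⟨j, h5⟩; omega
      · simp
      · simp
    · intro a j
      refine le_trans ?_ hmS
      simp only [initState]
      split_ifs with h1 h2 h3 h4
      · have := H.le_sz (I.p ⟨j, h1⟩); have := hitem ⟨j, h1⟩; omega
      · have := H.le_sz (I.L ⟨j, h1⟩); have := hitem ⟨j, h1⟩; omega
      · have := H.le_sz (I.U ⟨j, h1⟩); have := hitem ⟨j, h1⟩; omega
      · omega
      · omega
  obtain ⟨t, s, he, ht, -, hc⟩ := algorithm_ends (S := cellSize N m) (l := 1000 + N)
    (b := 4 * m + 7) I H le_rfl hS hsc hnS hbd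
  refine ⟨t, s, he, ht.trans (Nat.mul_le_mul_right _ ?_), hc⟩
  unfold steps
  gcongr

theorem exists_polynomial (N : ℕ) :
    ∃ q : Polynomial ℕ, ∀ m, q.eval m = runningTime N m := by
  let x : Polynomial ℕ := .X
  let a : Polynomial ℕ := .C N
  let d := (x * (2 * x * a) + 1) * (x + 1)
  refine ⟨(1 + (x * 4 + 2) + 1 + (x * (2 * x * a * 4 + 7) + 2) + ((x + 1) * d * 5 + 2) +
    (d * 4 + 2) + (d * 4 + 3) + (x * 5 + 2) + ((x + 1) * (x + 1) * (x * 6 + 9) + 4) +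
    (x * 4 + 3)) * ((1000 + a) * (1 + 2 * ((1000 + a) *
    ((x + 1) * d + a + x + 2 + (x * (4 * x + 8) + 1) + 1)))), fun m => ?_⟩
  simp [x, a, d, runningTime, steps, stepCost, cellSize]

end Algorithm

end KnapExp

namespace KnapExp

/-! ### Correctness -/

section Correct

variable {K : Type} [Field K] [LinearOrder K] {n : ℕ} (I : Inst K n)

theorem Inst.profit_le_optProfit {P : Finset (Fin n)} (hP : I.IsPacking P) :
    I.profit P ≤ I.optProfit :=
  Finset.le_sup' I.profit (Finset.mem_filter.2 ⟨Finset.mem_univ P, hP⟩)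

theorem Inst.exists_optProfit : ∃ P, I.IsPacking P ∧ I.profit P = I.optProfit := by
  obtain ⟨P, hP, h⟩ := Finset.exists_mem_eq_sup' I.packings_nonempty I.profit
  exact ⟨P, (Finset.mem_filter.1 hP).2, h.symm⟩

theorem exists_map_val {A : Finset ℕ} (hA : A ⊆ Finset.range n) :
    ∃ P : Finset (Fin n), P.map Fin.valEmbedding = A :=
  ⟨A.attachFin fun _ hi => Finset.mem_range.1 (hA hi), Finset.map_valEmbedding_attachFin _⟩

theorem map_val_subset_range (P : Finset (Fin n)) :
    P.map Fin.valEmbedding ⊆ Finset.range n := by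
  intro i hi
  obtain ⟨k, -, rfl⟩ := Finset.mem_map.1 hi
  exact Finset.mem_range.2 k.2

theorem sum_extend {M : Type} [AddCommMonoid M] (f : Fin n → M) (P : Finset (Fin n)) :
    ∑ i ∈ P.map Fin.valEmbedding, extend f i = ∑ i ∈ P, f i := by
  rw [Finset.sum_map]
  exact Finset.sum_congr rfl fun i _ => extend_val f i

theorem sum_ite_extend {M : Type} [AddCommMonoid M] (f g : Fin n → M) (P Q : Finset (Fin n)) :
    ∑ i ∈ P.map Fin.valEmbedding,
      (if i ∈ Q.map Fin.valEmbedding then extend f i else extend g i) =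
      ∑ i ∈ P, if i ∈ Q then f i else g i := by
  rw [Finset.sum_map]
  refine Finset.sum_congr rfl fun i _ => ?_
  have : Fin.valEmbedding i ∈ Q.map Fin.valEmbedding ↔ i ∈ Q := Finset.mem_map' _
  simp only [this]
  congr 1 <;> exact extend_val _ i

theorem Inst.mem_nontriv (N : ℕ) (i : Fin n) :
    (i : ℕ) ∈ nontriv n (I.data N).L (I.data N).U ↔ i ∉ I.trivialItems := by
  have h1 : (I.data N).L i = I.L i := extend_val _ _
  have h2 : (I.data N).U i = I.U i := extend_val _ _
  simp only [nontriv, Finset.mem_filter, Finset.mem_range, i.2, true_and, h1, h2, trivialItems,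
    Finset.mem_univ]
  refine not_congr ⟨fun h => ?_, fun h => h.ge⟩
  rcases I.interval i with hi | hi
  · exact absurd h (not_le.2 (hi.1.trans hi.2))
  · exact hi.1.trans hi.2.symm

/-- The guarantees for the computed query set, with `1 / N` in place of the accuracy. -/
structure Inst.Good (N : ℕ) (Q : Finset (Fin n)) : Prop where
  packing : ∃ P, I.IsPacking P ∧ P ⊆ Q ∪ I.trivialItems ∧
    N * I.optProfit ≤ N * I.profit P + I.optProfit
  upper : ∀ P, I.IsPacking P → I.upperOf Q P ≤ 4 * I.optProfit
  card_le : ∀ Q', I.Feasible Q' → Q.card ≤ 2 * Q'.card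

/-- Both halves are compared with the same feasible `Q`: the nontrivial items of `A` with those of
the optimal packing that `Q` reveals, and the best candidate with the one that `exists_candidate`
derives from `Q`. -/
theorem Computes.good [IsStrictOrderedRing K] {N pm xl xb j r : ℕ} {A : Finset ℕ} {s : State K}
    (hN : 0 < N) (h : Computes (I.data N) s pm xl xb j r A) : I.Good N (output n s) := by
  set C := I.data N with hC
  have hCn : C.n = n := rfl
  have hCB : C.B = I.B := rfl
  have hpack : ∀ P : Finset (Fin n), ∑ i ∈ P.map Fin.valEmbedding, C.w i ≤ C.B ↔ I.IsPacking P :=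
    fun P => by rw [show C.w = extend I.w from rfl, sum_extend]; rfl
  have hprof : ∀ P : Finset (Fin n), ∑ i ∈ P.map Fin.valEmbedding, C.p i = I.profit P :=
    fun P => sum_extend I.p P
  have hupper : ∀ P Q : Finset (Fin n), ∑ i ∈ P.map Fin.valEmbedding,
      (if i ∈ Q.map Fin.valEmbedding then C.p i else C.U i) = I.upperOf Q P :=
    fun P Q => sum_ite_extend I.p I.U P Q
  have ew : ∀ i (hi : i < n), C.w i = I.w ⟨i, hi⟩ := fun i hi => extend_val I.w ⟨i, hi⟩
  have ep : ∀ i (hi : i < n), C.p i = I.p ⟨i, hi⟩ := fun i hi => extend_val I.p ⟨i, hi⟩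
  have eL : ∀ i (hi : i < n), C.L i = I.L ⟨i, hi⟩ := fun i hi => extend_val I.L ⟨i, hi⟩
  have eU : ∀ i (hi : i < n), C.U i = I.U ⟨i, hi⟩ := fun i hi => extend_val I.U ⟨i, hi⟩
  have hw : ∀ i < n, C.w i ≤ C.B := fun i hi => by rw [ew i hi]; exact I.w_le _
  have hp : ∀ i < n, 0 ≤ C.p i := fun i hi => by rw [ep i hi]; exact I.p_nonneg _
  have hpU : ∀ i < n, C.p i ≤ C.U i := fun i hi => by
    rw [ep i hi, eU i hi]
    rcases I.interval ⟨i, hi⟩ with h | h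
    · exact h.2.le
    · exact h.2.ge
  have htriv : ∀ i < n, C.U i ≤ C.L i → C.U i = C.p i := fun i hi => by
    rw [ep i hi, eU i hi, eL i hi]
    rcases I.interval ⟨i, hi⟩ with h | h
    · exact fun h' => absurd h' (not_le.2 (h.1.trans h.2))
    · exact fun _ => h.2
  have hUn : C.U n = 0 := extend_of_le _ le_rfl
  have hwn : C.w n = 0 := extend_of_le _ le_rfl
  have hopt : ∀ P ⊆ Finset.range n, ∑ i ∈ P, C.w i ≤ C.B → ∑ i ∈ P, C.p i ≤ I.optProfit := by
    intro P hP hPw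
    obtain ⟨P, rfl⟩ := exists_map_val hP
    rw [hprof]
    exact I.profit_le_optProfit ((hpack P).1 hPw)
  obtain ⟨Po, hPo, hPop⟩ := I.exists_optProfit
  obtain ⟨k1, k2, k3, k4⟩ := scaling (n := n) (B := C.B) (w := C.w) (v := C.v pm) (p := C.p)
    (L := C.L) (U := C.U) (opt := I.optProfit) hN hw hp h.le_max h.max_lt
    (fun i hi => le_scaledProfit_mul
      (mul_le_mul_of_nonneg_left (h.le_max i hi) (Nat.cast_nonneg _)))
    (fun i _ u hu => lt_of_scaledProfit_eq hu) (fun i _ => C.v_le pm i)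
    h.last_le h.last h.best_le h.best h.subset h.sum_key hopt (map_val_subset_range Po)
    ((hpack Po).2 hPo) ((hprof Po).trans hPop)
  set F := (nontriv n C.L C.U).filter (Before (score C.w C.U j) r) with hF
  have hout : (output n s).map Fin.valEmbedding = (A ∩ nontriv n C.L C.U) ∪ F := by
    ext i
    simp only [Finset.mem_map, output, Finset.mem_filter, Finset.mem_univ, true_and,
      Finset.mem_union, Finset.mem_inter, hF]
    constructor
    · rintro ⟨k, hk, rfl⟩
      have := (h.mark_iff k k.2).1 hk
      simp only [Fin.valEmbedding_apply]
      tauto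
    · intro hi
      have hin : i ∈ nontriv n C.L C.U ∧ (i ∈ A ∨ Before (score C.w C.U j) r i) := by tauto
      have hi' : i < n := Finset.mem_range.1 (Finset.mem_filter.1 hin.1).1
      exact ⟨⟨i, hi'⟩, (h.mark_iff i hi').2 hin, rfl⟩
  obtain ⟨P₁, hP₁⟩ := exists_map_val (n := n) h.subset
  refine ⟨⟨P₁, ?_, ?_, ?_⟩, ?_, ?_⟩
  · rw [← hpack, hP₁]
    exact h.sum_weight
  · intro i hi
    rw [Finset.mem_union, or_iff_not_imp_right, ← I.mem_nontriv N]
    intro ht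
    rw [← Finset.mem_map' Fin.valEmbedding, hout, Finset.mem_union, Finset.mem_inter]
    left
    rw [← Finset.mem_map' Fin.valEmbedding, hP₁] at hi
    exact ⟨hi, ht⟩
  · rwa [← hprof, hP₁]
  · intro P hP
    -- The price may come from the dummy item `n`, whose upper limit is zero.
    have hUj : 0 ≤ C.U j := by
      rcases (show j ≤ n from h.price_le).lt_or_eq with hj | rfl
      · exact (hp j hj).trans (hpU j hj)
      · exact hUn.ge
    have := sum_upper_le (Q := (output n s).map Fin.valEmbedding) hp hpU hUj htriv
      (by rw [hout]; exact Finset.subset_union_right) h.remaining_le (map_val_subset_range P)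
      ((hpack P).2 hP) (hopt _ (map_val_subset_range P) ((hpack P).2 hP))
    rw [hupper] at this
    refine this.trans ?_
    change I.optProfit + C.p pm * (xl / (n + 1) : ℕ) / (n * N : ℕ) ≤ _
    linarith
  · intro Q hQ
    obtain ⟨⟨P, hP, hPQ, hPp⟩, hQ2⟩ := hQ
    obtain ⟨j', hj', r', hr', hrem, hcnt⟩ := exists_candidate (n := n) (B := C.B) (w := C.w)
      (p := C.p) (L := C.L) (U := C.U) (Q := Q.map Fin.valEmbedding) (opt := I.optProfit) hw
      (fun i hi => (hp i hi).trans (hpU i hi)) hUn hwn (by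
        intro P hP hPw
        obtain ⟨P, rfl⟩ := exists_map_val hP
        rw [hupper]
        exact hQ2 P ((hpack P).1 hPw))
    -- The candidate derived from `Q` has dual bound at most `2 * opt`, which is within the budget,
    -- so the search considered it.
    have c1 : F.card ≤ (Q.map Fin.valEmbedding ∩ nontriv n C.L C.U).card :=
      (h.queried_le j' hj' r' hr' (hrem.trans k3)).trans hcnt
    have c2 := k2 (P.map Fin.valEmbedding) (map_val_subset_range P) ((hpack P).2 hP)
      ((hprof P).trans hPp)
    have c3 : P.map Fin.valEmbedding ∩ nontriv n C.L C.U ⊆ Q.map Fin.valEmbedding := by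
      intro i hi
      rw [Finset.mem_inter, Finset.mem_map] at hi
      obtain ⟨⟨k, hk, rfl⟩, hi2⟩ := hi
      rw [Finset.mem_map']
      rcases Finset.mem_union.1 (hPQ hk) with hk | hk
      · exact hk
      · exact absurd hk ((I.mem_nontriv N k).1 hi2)
    have c4 := Finset.card_le_card c3
    have c5 := Finset.card_le_card
      (Finset.inter_subset_left : Q.map Fin.valEmbedding ∩ nontriv n C.L C.U ⊆ _)
    have c6 := Finset.card_union_le (A ∩ nontriv n C.L C.U) F
    rw [← hout] at c6
    simp only [Finset.card_map] at c4 c5 c6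
    omega

end Correct

/-! ### From `1 / N` to `ε`, and from rational to real guarantees -/

section Real

variable {n : ℕ}

theorem Inst.Good.abFeasible {I : Inst ℝ n} {N : ℕ} {ε : ℝ} {Q : Finset (Fin n)}
    (h : I.Good N Q) (hε : 0 < ε) (hN : 1 / ε ≤ N) :
    I.ABFeasible (1 / (1 - ε)) ((1 + ε) * 4) Q := by
  have hopt : 0 ≤ I.optProfit := by
    simpa [Inst.profit] using I.profit_le_optProfit (P := ∅) (by simp [Inst.IsPacking])
  have hN0 : (0 : ℝ) < N := (by positivity : 0 < 1 / ε).trans_le hN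
  refine ⟨?_, fun P hP => (h.upper P hP).trans ?_⟩
  · obtain ⟨P, hP, hPQ, hPp⟩ := h.packing
    refine ⟨P, hP, hPQ, ?_⟩
    -- This holds for `ε = 1` as well, since division by zero gives zero.
    rw [one_div_one_div]
    have h1 : 1 ≤ ε * N := by rwa [div_le_iff₀' hε] at hN
    have h2 := mul_le_mul_of_nonneg_right h1 hopt
    have h3 : N * ((1 - ε) * I.optProfit) ≤ N * I.profit P := by linarith
    exact le_of_mul_le_mul_left h3 hN0
  · have := mul_nonneg hε.le hopt
    linarith

theorem Inst.toReal_profit (I : Inst ℚ n) (P : Finset (Fin n)) :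
    I.toReal.profit P = (I.profit P : ℝ) := by
  simp [profit, toReal]

theorem Inst.toReal_optProfit (I : Inst ℚ n) : I.toReal.optProfit = (I.optProfit : ℝ) := by
  apply le_antisymm
  · obtain ⟨P, hP, h⟩ := I.toReal.exists_optProfit
    rw [← h, toReal_profit]
    exact_mod_cast I.profit_le_optProfit hP
  · obtain ⟨P, hP, h⟩ := I.exists_optProfit
    rw [← h, ← toReal_profit]
    exact I.toReal.profit_le_optProfit hP

theorem Inst.toReal_upperOf (I : Inst ℚ n) (Q P : Finset (Fin n)) :
    I.toReal.upperOf Q P = (I.upperOf Q P : ℝ) := by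
  simp only [upperOf, upper, toReal, Rat.cast_sum]
  exact Finset.sum_congr rfl fun i _ => by split_ifs <;> rfl

theorem Inst.toReal_trivialItems (I : Inst ℚ n) : I.toReal.trivialItems = I.trivialItems := by
  ext i
  simp [trivialItems, toReal]

theorem Inst.toReal_feasible (I : Inst ℚ n) {Q : Finset (Fin n)} :
    I.toReal.Feasible Q ↔ I.Feasible Q := by
  simp only [Feasible, toReal_trivialItems, toReal_profit, toReal_optProfit, toReal_upperOf,
    Rat.cast_inj, Rat.cast_le]
  rfl

theorem Inst.Good.toReal {I : Inst ℚ n} {N : ℕ} {Q : Finset (Fin n)} (h : I.Good N Q) :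
    I.toReal.Good N Q := by
  obtain ⟨⟨P, hP, hPQ, hPp⟩, hU, hc⟩ := h
  refine ⟨⟨P, hP, by rwa [toReal_trivialItems], ?_⟩, fun P hP => ?_, fun Q' hQ' => ?_⟩
  · rw [toReal_profit, toReal_optProfit]
    exact_mod_cast hPp
  · rw [toReal_upperOf, toReal_optProfit]
    exact_mod_cast hU P hP
  · exact hc Q' (I.toReal_feasible.1 hQ')

end Real

end KnapExp

theorem mainTheorem4 (ε : ℝ) (hε : 0 < ε) :
    ∃ (prog : KnapExp.Cmd) (q : Polynomial ℕ),
      (∀ (n : ℕ) (I : KnapExp.Inst ℚ n),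
        ∃ (t : ℕ) (s : KnapExp.State ℚ),
          KnapExp.Exec KnapExp.bitSize prog (KnapExp.initState I) t s ∧
          t ≤ q.eval (I.inputSize KnapExp.bitSize) ∧
          I.toReal.ABFeasible (1 / (1 - ε)) ((1 + ε) * 4) (KnapExp.output n s) ∧
          ∀ Qopt : Finset (Fin n), I.toReal.IsOptimal Qopt →
            (KnapExp.output n s).card ≤ 2 * Qopt.card) ∧
      (∀ (n : ℕ) (I : KnapExp.Inst ℝ n),
        ∃ (t : ℕ) (s : KnapExp.State ℝ),
          KnapExp.Exec KnapExp.unitSize prog (KnapExp.initState I) t s ∧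
          t ≤ q.eval (I.inputSize KnapExp.unitSize) ∧
          I.ABFeasible (1 / (1 - ε)) ((1 + ε) * 4) (KnapExp.output n s) ∧
          ∀ Qopt : Finset (Fin n), I.IsOptimal Qopt →
            (KnapExp.output n s).card ≤ 2 * Qopt.card) := by
  obtain ⟨N, hN⟩ := exists_nat_ge (1 / ε)
  have hN0 : 0 < N := Nat.cast_pos.1 ((by positivity : 0 < 1 / ε).trans_le hN)
  obtain ⟨q, hq⟩ := KnapExp.exists_polynomial N
  refine ⟨KnapExp.algorithm N, q, fun n I => ?_, fun n I => ?_⟩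
  · obtain ⟨t, s, he, ht, pm, xl, xb, j, r, A, hc⟩ :=
      KnapExp.algorithm_runs N I KnapExp.sizeBound_bitSize
    have hg := (hc.good I hN0).toReal
    exact ⟨t, s, he, by rwa [hq], hg.abFeasible hε hN, fun Q hQ => hg.card_le Q hQ.1⟩
  · obtain ⟨t, s, he, ht, pm, xl, xb, j, r, A, hc⟩ :=
      KnapExp.algorithm_runs N I KnapExp.sizeBound_unitSize
    have hg := hc.good I hN0
    exact ⟨t, s, he, by rwa [hq], hg.abFeasible hε hN, fun Q hQ => hg.card_le Q hQ.1⟩
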